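/- Let $I\subseteq\mathbb{R}$ be an interval, bounded or not, and let $\mathfrak{F}=\bigoplus_{N\ge 0}L^2_{\mathrm{sym}}(I^N)$ be the bosonic Fock space over $L^2(I)$, with vacuum $\Omega$ and annihilation field $(\psi(x)f)_N(y_1,\dots,y_N)=\sqrt{N+1}\,f_{N+1}(x,y_1,\dots,y_N)$. Let $\mathcal{D}\subseteq\mathfrak{F}$ be the dense subspace of all $f$ with $\sum_N c^N\|f_N\|^2<\infty$ for every $c>0$. Let $D\ge 0$, let $B\in M_D(\mathbb{C})$, and let $Q,L,R,T$ be $M_D(\mathbb{C})$-valued functions on $I$ with entries in $L^1(I)$, $L^2(I)$, $L^2(I)$, $L^\infty(I)$ respectively; call such $(B,Q,L,R,T)$ admissible tensors. Put $\mathfrak{L}_x=Q(x)\otimes\mathrm{Id}+L(x)\otimes l_x+R(x)\otimes r_x+T(x)\otimes\mathrm{Ad}_x$, where $l_x[X]=\psi^\dagger(x)X$, $r_x[X]=X\psi(x)$ and $\mathrm{Ad}_x[X]=\psi^\dagger(x)X\psi(x)$. A linear operator $O:\mathcal{D}\to\mathcal{D}$ is the continuous matrix product operator (cMPO) with tensors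 $(B,Q,L,R,T)$, of bond dimension $D$, written $$O=\mathrm{Tr}_D\Big(B\,\mathcal{P}e^{\int_I\mathfrak{L}_x\,dx}\Big)\big(|\Omega\rangle\langle\Omega|\big),$$ if it is given by the Dyson series of this path-ordered exponential, that is, if for all $g\in\mathfrak{F}$ and $f\in\mathcal{D}$ $$\langle g,Of\rangle=\sum_{n\ge 0}\ \int_{x_1<\dots<x_n,\ x_i\in I}\mathrm{Tr}_D\Big(B\,\langle g|\,\mathfrak{L}_{x_1}\cdots\mathfrak{L}_{x_n}\big[\mathbb{1}_D\otimes|\Omega\rangle\langle\Omega|\big]\,|f\rangle\Big)\,dx_1\cdots dx_n ,$$ where every integrand is integrable, the series converges unconditionally, and matrix elements are read as $\langle g|\psi^\dagger(x)X|f\rangle=\langle\psi(x)g|X|f\rangle$. Then: 1. For all admissible tensors $(B,Q,L,R,T)$ there is exactly one operator $O:\mathcal{D}\to\mathcal{D}$ that is the cMPO with these tensors. 2. If $O_1$ and $O_2$ are the cMPOs with admissible tensors $(B_i,Q_i,L_i,R_i,T_i)$ of bond dimension $D_i$ ($i=1,2$), then the product $O_1O_2:\mathcal{D}\to\mathcal{D}$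 is again a cMPO, of bond dimension at most $D_1D_2$. The tensors $$B=B_1\otimes B_2,\qquad T=T_1\otimes T_2,\qquad Q=Q_1\otimes\mathbb{1}+\mathbb{1}\otimes Q_2+R_1\otimes L_2,$$ $$L=L_1\otimes\mathbb{1}+T_1\otimes L_2,\qquad R=\mathbb{1}\otimes R_2+R_1\otimes T_2$$ are admissible, and $O_1O_2$ is the cMPO with these tensors. -/

import Mathlib

open MeasureTheory
open scoped ENNReal ComplexConjugate Kronecker InnerProductSpace

noncomputable section

namespace CMPO

/-! ### The bosonic Fock space over `L²(I)` -/

/-- The measure `dx₁ ⋯ dx_N` on `I^N`. -/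
abbrev configMeasure (I : Set ℝ) (N : ℕ) : Measure (Fin N → ℝ) :=
  Measure.pi fun _ => (volume : Measure ℝ).restrict I

/-- Relabelling the particles preserves `dx₁ ⋯ dx_N`. -/
theorem measurePreserving_perm (I : Set ℝ) {N : ℕ} (σ : Equiv.Perm (Fin N)) :
    MeasurePreserving (fun x : Fin N → ℝ => x ∘ σ) (configMeasure I N) (configMeasure I N) := by
  have h := measurePreserving_piCongrLeft
    (fun _ : Fin N => (volume : Measure ℝ).restrict I) σ.symm
  have e : (fun x : Fin N → ℝ => x ∘ σ) =
      MeasurableEquiv.piCongrLeft (fun _ : Fin N => ℝ) σ.symm := by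
    funext x i
    have := Equiv.piCongrLeft_apply_apply (fun _ : Fin N => ℝ) σ.symm x (σ i)
    simpa [MeasurableEquiv.coe_piCongrLeft] using this.symm
  rw [e]
  exact h

/-- The `N`-particle space: the elements of `L²(I^N)` that are symmetric under permutation of
the particles. -/
def sector (I : Set ℝ) (N : ℕ) : Submodule ℂ (Lp ℂ 2 (configMeasure I N)) :=
  ⨅ σ : Equiv.Perm (Fin N),
    LinearMap.eqLocus (Lp.compMeasurePreservingₗ ℂ _ (measurePreserving_perm I σ)) LinearMap.id

/-- The Fock space: the Hilbert sum of the symmetric `N`-particle spaces. -/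
abbrev Fock (I : Set ℝ) : Type := lp (fun N : ℕ => sector I N) 2

/-- The vectors `f` of the Fock space with `∑ c^N ‖f_N‖² < ∞` for every `c`. They form a dense
subspace, which contains all vectors of finite particle number and all coherent states. -/
def expDomain (I : Set ℝ) : Submodule ℂ (Fock I) where
  carrier := {f | ∀ c : ℝ, Summable fun N : ℕ => c ^ N * ‖f N‖ ^ 2}
  zero_mem' := by
    intro c
    simp
  add_mem' := by
    intro f g hf hg c
    have h := ((hf |c|).add (hg |c|)).mul_left 2
    refine Summable.of_norm_bounded h fun N => ?_
    have h1 : ‖(f + g) N‖ ≤ ‖f N‖ + ‖g N‖ := by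
      rw [lp.coeFn_add, Pi.add_apply]
      exact norm_add_le _ _
    have h2 : ‖(f + g) N‖ ^ 2 ≤ 2 * (‖f N‖ ^ 2 + ‖g N‖ ^ 2) := by
      nlinarith [norm_nonneg ((f + g) N), norm_nonneg (f N), norm_nonneg (g N),
        sq_nonneg (‖f N‖ - ‖g N‖)]
    have h3 : 0 ≤ |c| ^ N := pow_nonneg (abs_nonneg c) N
    rw [norm_mul, norm_pow, norm_pow, norm_norm, Real.norm_eq_abs]
    nlinarith [mul_le_mul_of_nonneg_left h2 h3]
  smul_mem' := by
    intro a f hf c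
    have h := (hf c).mul_left (‖a‖ ^ 2)
    refine h.congr fun N => ?_
    rw [lp.coeFn_smul, Pi.smul_apply, norm_smul]
    ring

/-- `expDomain I` is dense in the Fock space. -/
theorem dense_expDomain (I : Set ℝ) : Dense (expDomain I : Set (Fock I)) := by
  intro f
  have h := lp.hasSum_single (E := fun N : ℕ => sector I N) (p := 2) (by simp) f
  refine mem_closure_of_tendsto h (Filter.Eventually.of_forall fun s => ?_)
  refine Submodule.sum_mem _ fun N _ c => ?_
  refine summable_of_ne_finset_zero (s := {N}) fun M hM => ?_
  have hMN : M ≠ N := by simpa using hM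
  have : (lp.single 2 N (f N) : Fock I) M = 0 := by
    simp [lp.single_apply, hMN]
  rw [this]
  simp

/-! ### Field operators and supermaps

Operators are described by their matrix elements `⟨g|X|f⟩`. -/

/-- Sequences of `N`-particle wave functions. -/
abbrev WaveFn : Type := (N : ℕ) → (Fin N → ℝ) → ℂ

/-- The wave functions of a Fock space vector. -/
def wave {I : Set ℝ} (f : Fock I) : WaveFn := fun N => ((f N : Lp ℂ 2 (configMeasure I N)) : _ → ℂ)

/-- The annihilation field: `(ψ(x) φ)_N (y₁, …, y_N) = √(N+1) φ_{N+1} (x, y₁, …, y_N)`. -/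
def annih (x : ℝ) (φ : WaveFn) : WaveFn :=
  fun N y => (Real.sqrt (N + 1) : ℂ) * φ (N + 1) (Fin.cons x y)

/-- Matrix elements `(g, f) ↦ ⟨g|X|f⟩`; with `V = Matrix ι ι ℂ`, these are the matrix elements
of an element `X` of `M_D(ℂ) ⊗ operators`. -/
abbrev Form (V : Type) : Type := WaveFn → WaveFn → V

/-- `l_x[X] = ψ†(x) X`, that is `⟨g|l_x[X]|f⟩ = ⟨ψ(x) g|X|f⟩`. -/
def lMap {V : Type} (x : ℝ) (X : Form V) : Form V := fun g f => X (annih x g) f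

/-- `r_x[X] = X ψ(x)`. -/
def rMap {V : Type} (x : ℝ) (X : Form V) : Form V := fun g f => X g (annih x f)

/-- `Ad_x[X] = ψ†(x) X ψ(x)`. -/
def adMap {V : Type} (x : ℝ) (X : Form V) : Form V := fun g f => X (annih x g) (annih x f)

/-- `1_D ⊗ |Ω⟩⟨Ω|`. -/
def vacuumProj (ι : Type) [Fintype ι] [DecidableEq ι] : Form (Matrix ι ι ℂ) :=
  fun g f => (conj (g 0 Fin.elim0) * f 0 Fin.elim0) • (1 : Matrix ι ι ℂ)

/-! ### Continuous matrix product operators -/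

/-- A boundary matrix and four matrix-valued functions. The bond dimension is the cardinality
of `ι`. -/
structure Tensors (ι : Type) where
  B : Matrix ι ι ℂ
  Q : ℝ → Matrix ι ι ℂ
  L : ℝ → Matrix ι ι ℂ
  R : ℝ → Matrix ι ι ℂ
  T : ℝ → Matrix ι ι ℂ

/-- The entries of `Q`, `L`, `R`, `T` lie in `L¹(I)`, `L²(I)`, `L²(I)`, `L^∞(I)`. -/
structure Tensors.Admissible {ι : Type} (I : Set ℝ) (A : Tensors ι) : Prop where
  Q_mem : ∀ i j, MemLp (fun x => A.Q x i j) 1 (volume.restrict I)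
  L_mem : ∀ i j, MemLp (fun x => A.L x i j) 2 (volume.restrict I)
  R_mem : ∀ i j, MemLp (fun x => A.R x i j) 2 (volume.restrict I)
  T_mem : ∀ i j, MemLp (fun x => A.T x i j) ∞ (volume.restrict I)

section

variable {ι κ : Type} [Fintype ι] [DecidableEq ι] [Fintype κ] [DecidableEq κ]

/-- `𝔏_x = Q(x) ⊗ Id + L(x) ⊗ l_x + R(x) ⊗ r_x + T(x) ⊗ Ad_x`. -/
def generator (A : Tensors ι) (x : ℝ) (X : Form (Matrix ι ι ℂ)) : Form (Matrix ι ι ℂ) :=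
  fun g f => A.Q x * X g f + A.L x * lMap x X g f + A.R x * rMap x X g f + A.T x * adMap x X g f

/-- `Tr_D (B 𝔏_{x₁} ⋯ 𝔏_{x_n} [1_D ⊗ |Ω⟩⟨Ω|])`. -/
def dysonIntegrand (A : Tensors ι) {n : ℕ} (x : Fin n → ℝ) : Form ℂ :=
  fun g f => (A.B * (List.ofFn x).foldr (generator A) (vacuumProj ι) g f).trace

/-- `O = Tr_D (B 𝒫 exp ∫_I 𝔏_x dx) (|Ω⟩⟨Ω|)` as an operator on `expDomain I`: the path-ordered
exponential is its Dyson series, with the integrals over `x₁ < ⋯ < x_n` in `I`, and the series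
converges weakly against every vector of the Fock space. -/
def IsCMPOWith (I : Set ℝ) (A : Tensors ι) (O : expDomain I →ₗ[ℂ] expDomain I) : Prop :=
  A.Admissible I ∧ ∀ (g : Fock I) (f : expDomain I),
    (∀ n : ℕ, IntegrableOn (fun x : Fin n → ℝ => dysonIntegrand A x (wave g) (wave (f : Fock I)))
      {x | StrictMono x} (configMeasure I n)) ∧
    HasSum (fun n : ℕ => ∫ x : Fin n → ℝ in {x | StrictMono x},
      dysonIntegrand A x (wave g) (wave (f : Fock I)) ∂(configMeasure I n))
      ⟪g, (O f : Fock I)⟫_ℂ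

/-- `O` is a cMPO on `I` with bond dimension `D`. -/
def IsCMPO (I : Set ℝ) (D : ℕ) (O : expDomain I →ₗ[ℂ] expDomain I) : Prop :=
  ∃ A : Tensors (Fin D), IsCMPOWith I A O

/-- The tensors of the product. -/
def Tensors.prod (A₁ : Tensors ι) (A₂ : Tensors κ) : Tensors (ι × κ) where
  B := A₁.B ⊗ₖ A₂.B
  Q x := A₁.Q x ⊗ₖ 1 + 1 ⊗ₖ A₂.Q x + A₁.R x ⊗ₖ A₂.L x
  L x := A₁.L x ⊗ₖ 1 + A₁.T x ⊗ₖ A₂.L x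
  R x := 1 ⊗ₖ A₂.R x + A₁.R x ⊗ₖ A₂.T x
  T x := A₁.T x ⊗ₖ A₂.T x

end

end CMPO

end

/-!
Writing `√(n!) f_n` for the `n`-particle function of `f`, the Fock space becomes the symmetric
`L²` space of finite configurations of points in `I`, with the Lebesgue–Poisson measure
`∑ dx₁ ⋯ dx_n / n!`. Expanding `𝔏_x` into its four terms gives every point of a Dyson integral one
of four kinds, according to whether it creates and whether it annihilates a particle. The Dyson
series thereby becomes an integral over configurations `ω` of points labelled by their kinds,
with integrand `κ(ω) * conj (g (created points)) * f (annihilated points)` and kernel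
`κ(ω) = Tr (B M(x₁) ⋯ M(x_n))`: a Maassen integral kernel operator.

The kernel has a multiplicative bound `C * ∏ m(x)` with `m` in `L¹`, `L²`, `L²`, `L^∞` on the four
kinds. By Cauchy–Schwarz such a kernel maps functions with all exponential moments to functions
with all exponential moments, so the series converges absolutely and defines `O`; uniqueness holds
because the series fixes all matrix elements.

When two kernels are composed, a point of the result belongs to the first factor alone, to the
second factor alone, or to both, in the last case annihilated by the first and created by the
second. Collecting these possibilities at a single point gives the eight terms of the product
tensors; `R₁ ⊗ L₂`, `T₁ ⊗ L₂`, `R₁ ⊗ T₂` and `T₁ ⊗ T₂` come from the common points.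
-/

noncomputable section

namespace CMPO

/-! ### Measurable structure on lists and multisets -/

section ListMeasurable

variable {X Y Z : Type*} [MeasurableSpace X] [MeasurableSpace Y] [MeasurableSpace Z]

/-- Lists carry the disjoint union of the product `σ`-algebras on tuples. -/
instance : MeasurableSpace (List X) :=
  ⨅ n : ℕ, MeasurableSpace.map (fun x : Fin n → X => List.ofFn x) inferInstance

/-- Multisets carry the quotient `σ`-algebra: its elements are the permutation-invariant
measurable sets of lists. -/
instance : MeasurableSpace (Multiset X) :=
  MeasurableSpace.map (fun l : List X => (l : Multiset X)) inferInstance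

theorem measurableSet_list_iff {S : Set (List X)} :
    MeasurableSet S ↔ ∀ n : ℕ, MeasurableSet {x : Fin n → X | List.ofFn x ∈ S} :=
  MeasurableSpace.measurableSet_iInf

theorem measurable_list_iff {f : List X → Z} :
    Measurable f ↔ ∀ n : ℕ, Measurable fun x : Fin n → X => f (List.ofFn x) :=
  ⟨fun h n _ hS => measurableSet_list_iff.1 (h hS) n,
    fun h _ hS => measurableSet_list_iff.2 fun n => h n hS⟩

theorem measurable_ofFn (n : ℕ) : Measurable fun x : Fin n → X => List.ofFn x :=
  measurable_list_iff.1 measurable_id n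

@[fun_prop]
theorem measurable_multiset_coe {f : Y → List X} (hf : Measurable f) :
    Measurable fun y => (f y : Multiset X) :=
  fun _ hS => hf hS

theorem measurable_multiset_iff {f : Multiset X → Z} :
    Measurable f ↔ Measurable fun l : List X => f l :=
  Iff.rfl

theorem measurableEmbedding_ofFn (n : ℕ) :
    MeasurableEmbedding fun x : Fin n → X => List.ofFn x where
  injective := List.ofFn_injective
  measurable := measurable_ofFn n
  measurableSet_image' S hS := by
    refine measurableSet_list_iff.2 fun m => ?_
    rcases eq_or_ne m n with rfl | hmn
    · simpa only [List.ofFn_injective.mem_set_image, Set.ofPred_mem_eq] using hS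
    · convert MeasurableSet.empty using 1
      refine Set.eq_empty_of_forall_notMem fun x hx => ?_
      obtain ⟨y, -, hyx⟩ := hx
      exact hmn (by simpa only [List.length_ofFn] using (congrArg List.length hyx).symm)

theorem measurable_prod_list_iff {f : Y × List X → Z} :
    Measurable f ↔ ∀ n : ℕ, Measurable fun p : Y × (Fin n → X) => f (p.1, List.ofFn p.2) := by
  refine ⟨fun h n => h.comp (measurable_id.prodMap (measurable_ofFn n)), fun h S hS => ?_⟩
  have preimage_eq : f ⁻¹' S = ⋃ n : ℕ, Prod.map id (fun x : Fin n → X => List.ofFn x) ''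
      {p | f (p.1, List.ofFn p.2) ∈ S} := by
    ext ⟨y, l⟩
    simp only [Set.mem_preimage, Set.mem_iUnion, Set.mem_image, Set.mem_ofPred_eq, Prod.exists,
      Prod.map_apply, id_eq, Prod.mk.injEq]
    constructor
    · intro hl
      exact ⟨l.length, y, l.get, by simpa only [List.ofFn_get] using hl, rfl, List.ofFn_get l⟩
    · rintro ⟨n, y', x, hx, rfl, rfl⟩
      exact hx
  rw [preimage_eq]
  exact MeasurableSet.iUnion fun n =>
    (MeasurableEmbedding.id.prodMap (measurableEmbedding_ofFn n)).measurableSet_image' (h n hS)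

@[fun_prop]
theorem measurable_list_cons {f : Y → X} {g : Y → List X} (hf : Measurable f)
    (hg : Measurable g) : Measurable fun y => f y :: g y := by
  suffices Measurable fun p : X × List X => p.1 :: p.2 from this.comp (hf.prodMk hg)
  refine measurable_prod_list_iff.2 fun n => ?_
  simp only [← List.ofFn_cons]
  exact (measurable_ofFn (n + 1)).comp (measurable_pi_iff.2
    (Fin.cases (by simpa only [Fin.cons_zero] using measurable_fst)
      fun j => by simp only [Fin.cons_succ]; fun_prop))

theorem measurable_prod_list_of_cons {f : Y × List X → Z} (f_nil : Measurable fun y => f (y, []))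
    (step : Y × X × List X × Z → Z) (hstep : Measurable step)
    (f_cons : ∀ y x l, f (y, x :: l) = step (y, x, l, f (y, l))) : Measurable f := by
  refine measurable_prod_list_iff.2 fun n => ?_
  induction n with
  | zero => simpa only [List.ofFn_zero] using f_nil.fun_comp measurable_fst
  | succ n ih =>
    have tail_meas : Measurable fun p : Y × (Fin (n + 1) → X) =>
        (p.1, fun i : Fin n => p.2 i.succ) := by fun_prop
    simp only [List.ofFn_succ, f_cons]
    exact hstep.comp (measurable_fst.prodMk (Measurable.prodMk (by fun_prop)
      (((measurable_ofFn n).comp (measurable_snd.comp tail_meas)).prodMk (ih.comp tail_meas))))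

theorem measurable_list_of_cons {f : List X → Z} (step : X × List X × Z → Z)
    (hstep : Measurable step) (f_cons : ∀ x l, f (x :: l) = step (x, l, f l)) : Measurable f := by
  have hf : Measurable fun p : Unit × List X => f p.2 :=
    measurable_prod_list_of_cons (measurable_const (a := f [])) (fun p => step p.2)
      (hstep.comp measurable_snd) fun _ => f_cons
  exact hf.comp (measurable_const.prodMk measurable_id : Measurable fun l : List X => ((), l))

@[fun_prop]
theorem measurable_list_map {f : X → Y} (hf : Measurable f) : Measurable (List.map f) :=
  measurable_list_of_cons (fun p => f p.1 :: p.2.2) (by fun_prop) fun _ _ => rfl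

@[fun_prop]
theorem measurable_list_length : Measurable (List.length : List X → ℕ) :=
  measurable_list_of_cons (fun q => q.2.2 + 1) (by fun_prop) fun _ _ => rfl

@[fun_prop]
theorem measurable_list_append {f g : Y → List X} (hf : Measurable f) (hg : Measurable g) :
    Measurable fun y => f y ++ g y := by
  suffices Measurable fun p : List X × List X => p.2 ++ p.1 from this.comp (hg.prodMk hf)
  exact measurable_prod_list_of_cons measurable_id (fun q => q.2.1 :: q.2.2.2) (by fun_prop)
    fun _ _ _ => rfl

@[fun_prop]
theorem measurable_multiset_map {f : X → Y} (hf : Measurable f) :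
    Measurable (Multiset.map f) :=
  measurable_multiset_iff.2 (measurable_multiset_coe (measurable_list_map hf))

theorem measurable_multiset_filter {p : X → Prop} [DecidablePred p]
    (hp : MeasurableSet {x | p x}) : Measurable (Multiset.filter p) := by
  refine measurable_multiset_iff.2 (measurable_multiset_coe (f := List.filter fun x => p x) ?_)
  refine measurable_list_of_cons (fun q => if p q.1 then q.1 :: q.2.2 else q.2.2)
    (Measurable.ite (measurable_fst hp) (by fun_prop) (by fun_prop)) fun x l => ?_
  simp only [List.filter_cons, decide_eq_true_eq]

@[fun_prop]
theorem measurable_multiset_card : Measurable (Multiset.card : Multiset X → ℕ) :=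
  measurable_multiset_iff.2 measurable_list_length

@[fun_prop]
theorem measurable_multiset_prod {M : Type*} [CommMonoid M] [MeasurableSpace M]
    [MeasurableMul₂ M] : Measurable (Multiset.prod : Multiset M → M) :=
  measurable_multiset_iff.2 (measurable_list_of_cons (fun q => q.1 * q.2.2) (by fun_prop)
    fun x l => by simp only [Multiset.prod_coe, List.prod_cons])

theorem measurable_list_orderedInsert {r : X → X → Prop} [DecidableRel r]
    (hr : MeasurableSet {p : X × X | r p.1 p.2}) :
    Measurable fun p : X × List X => List.orderedInsert r p.1 p.2 := by
  refine measurable_prod_list_of_cons (by simp only [List.orderedInsert_nil]; fun_prop)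
    (fun q => if r q.1 q.2.1 then q.1 :: q.2.1 :: q.2.2.1 else q.2.1 :: q.2.2.2)
    (Measurable.ite ?_ (by fun_prop) (by fun_prop)) fun y x l => ?_
  · exact (measurable_fst.prodMk (measurable_fst.comp measurable_snd) :
      Measurable fun q : X × X × List X × List X => (q.1, q.2.1)) hr
  · simp only [List.orderedInsert_cons]

theorem measurable_multiset_sort {r : X → X → Prop} [DecidableRel r] [IsTrans X r]
    [Std.Antisymm r] [Std.Total r] (hr : MeasurableSet {p : X × X | r p.1 p.2}) :
    Measurable fun m : Multiset X => m.sort r := by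
  refine measurable_multiset_iff.2 ?_
  simp only [Multiset.coe_sort, List.mergeSort_eq_insertionSort]
  exact measurable_list_of_cons (fun q => List.orderedInsert r q.1 q.2.2)
    ((measurable_list_orderedInsert hr).comp
      (measurable_fst.prodMk (measurable_snd.comp measurable_snd))) fun _ _ => rfl

end ListMeasurable

/-! ### The Lebesgue–Poisson measure on finite configurations -/

section Poisson

variable {X Y : Type*} [MeasurableSpace X] [MeasurableSpace Y]

/-- The product measure `μ^n`, carried by the lists of length `n`. -/
def tupleMeasure (μ : Measure X) : ℕ → Measure (List X)
  | 0 => Measure.dirac []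
  | n + 1 => (μ.prod (tupleMeasure μ n)).map fun p => p.1 :: p.2

/-- The Lebesgue–Poisson measure `∑ μ^n / n!`. It lives on lists, rather than on multisets, because
addition is jointly measurable only there; the functions integrated are those of multisets. -/
def poisson (μ : Measure X) : Measure (List X) :=
  Measure.sum fun n : ℕ => ((n.factorial : ℝ≥0∞)⁻¹) • tupleMeasure μ n

instance (μ : Measure X) [SFinite μ] (n : ℕ) : SFinite (tupleMeasure μ n) := by
  induction n <;> unfold tupleMeasure <;> infer_instance

instance (μ : Measure X) [SFinite μ] : SFinite (poisson μ) := by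
  unfold poisson
  infer_instance

theorem lintegral_tupleMeasure_zero (μ : Measure X) {F : List X → ℝ≥0∞} (hF : Measurable F) :
    ∫⁻ l, F l ∂tupleMeasure μ 0 = F [] :=
  lintegral_dirac' _ hF

theorem lintegral_tupleMeasure_succ (μ : Measure X) [SFinite μ] (n : ℕ) {F : List X → ℝ≥0∞}
    (hF : Measurable F) :
    ∫⁻ l, F l ∂tupleMeasure μ (n + 1) = ∫⁻ x, ∫⁻ l, F (x :: l) ∂tupleMeasure μ n ∂μ := by
  rw [tupleMeasure, lintegral_map hF (by fun_prop), lintegral_prod _ (by fun_prop)]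

theorem lintegral_poisson (μ : Measure X) (F : List X → ℝ≥0∞) :
    ∫⁻ l, F l ∂poisson μ = ∑' n : ℕ, (n.factorial : ℝ≥0∞)⁻¹ * ∫⁻ l, F l ∂tupleMeasure μ n := by
  simp only [poisson, lintegral_sum_measure, lintegral_smul_measure, smul_eq_mul]

/-- A point of `μ + ν` comes from `μ` or from `ν`; a symmetric function does not see at which
positions, which accounts for the binomial coefficients. -/
theorem lintegral_tupleMeasure_add (μ ν : Measure X) [SFinite μ] [SFinite ν] (n : ℕ)
    {F : Multiset X → ℝ≥0∞} (hF : Measurable F) :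
    ∫⁻ l, F l ∂tupleMeasure (μ + ν) n =
      ∑ ij ∈ Finset.HasAntidiagonal.antidiagonal n, (n.choose ij.1 : ℝ≥0∞) *
      ∫⁻ α, ∫⁻ β, F (α ++ β : List X) ∂tupleMeasure ν ij.2 ∂tupleMeasure μ ij.1 := by
  induction n generalizing F with
  | zero =>
    rw [lintegral_tupleMeasure_zero _ (by fun_prop), Finset.HasAntidiagonal.antidiagonal_zero,
      Finset.sum_singleton, lintegral_tupleMeasure_zero _ (by fun_prop),
      lintegral_tupleMeasure_zero _ (by fun_prop), Nat.choose_self, Nat.cast_one, one_mul,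
      List.append_nil]
  | succ n ih =>
    have cons_meas (x : X) : Measurable fun m : Multiset X => F (x ::ₘ m) :=
      measurable_multiset_iff.2 (by simp only [Multiset.cons_coe]; fun_prop)
    have from_left (i j : ℕ) :
        ∫⁻ x, ∫⁻ α, ∫⁻ β, F (x :: (α ++ β) : List X) ∂tupleMeasure ν j ∂tupleMeasure μ i ∂μ =
          ∫⁻ α, ∫⁻ β, F (α ++ β : List X) ∂tupleMeasure ν j ∂tupleMeasure μ (i + 1) := by
      rw [lintegral_tupleMeasure_succ _ _ (by fun_prop)]
      simp only [List.cons_append]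
    have from_right (i j : ℕ) :
        ∫⁻ x, ∫⁻ α, ∫⁻ β, F (x :: (α ++ β) : List X) ∂tupleMeasure ν j ∂tupleMeasure μ i ∂ν =
          ∫⁻ α, ∫⁻ β, F (α ++ β : List X) ∂tupleMeasure ν (j + 1) ∂tupleMeasure μ i := by
      rw [lintegral_lintegral_swap (by fun_prop)]
      refine lintegral_congr fun α => ?_
      rw [lintegral_tupleMeasure_succ _ _ (by fun_prop)]
      simp only [Multiset.coe_eq_coe.2 List.perm_middle]
    rw [lintegral_tupleMeasure_succ _ _ (by fun_prop)]
    simp only [← Multiset.cons_coe, ih (cons_meas _), lintegral_add_measure]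
    simp only [Multiset.cons_coe]
    have term_meas (a : ℝ≥0∞) (i j : ℕ) : Measurable fun x : X => a *
        ∫⁻ α, ∫⁻ β, F (x :: (α ++ β) : List X) ∂tupleMeasure ν j ∂tupleMeasure μ i := by fun_prop
    simp_rw [lintegral_finsetSum _ fun _ _ => term_meas _ _ _,
      lintegral_const_mul' _ _ (ENNReal.natCast_ne_top _)]
    rw [Finset.sum_antidiagonal_choose_succ_mul (fun i j =>
      ∫⁻ α, ∫⁻ β, F (α ++ β : List X) ∂tupleMeasure ν j ∂tupleMeasure μ i) n, add_comm]
    simp only [from_left, from_right]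
    congr 1
    refine Finset.sum_congr rfl fun ij hij => ?_
    rw [Nat.choose_symm_of_eq_add (Finset.HasAntidiagonal.mem_antidiagonal.1 hij).symm]

theorem inv_factorial_mul_choose (i j : ℕ) :
    ((i + j).factorial : ℝ≥0∞)⁻¹ * (i + j).choose i =
      (i.factorial : ℝ≥0∞)⁻¹ * (j.factorial : ℝ≥0∞)⁻¹ := by
  have choose_ne_zero : ((i + j).choose i : ℝ≥0∞) ≠ 0 :=
    Nat.cast_ne_zero.2 (Nat.choose_pos (Nat.le_add_right i j)).ne'
  have factorial_eq : ((i + j).factorial : ℝ≥0∞) =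
      (i + j).choose i * (i.factorial * j.factorial) := by
    exact_mod_cast (by rw [← Nat.add_choose_mul_factorial_mul_factorial i j, mul_assoc,
      Nat.choose_symm_add] : (i + j).factorial = (i + j).choose i * (i.factorial * j.factorial))
  rw [factorial_eq, ENNReal.mul_inv (.inl choose_ne_zero) (.inl (ENNReal.natCast_ne_top _)),
    mul_right_comm, ENNReal.inv_mul_cancel choose_ne_zero (ENNReal.natCast_ne_top _), one_mul,
    ENNReal.mul_inv (.inr (ENNReal.natCast_ne_top _)) (.inl (ENNReal.natCast_ne_top _))]

theorem lintegral_poisson_add (μ ν : Measure X) [SFinite μ] [SFinite ν]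
    {F : Multiset X → ℝ≥0∞} (hF : Measurable F) :
    ∫⁻ l, F l ∂poisson (μ + ν) = ∫⁻ α, ∫⁻ β, F (α ++ β : List X) ∂poisson ν ∂poisson μ := by
  have inner_meas (j : ℕ) :
      Measurable fun α : List X => ∫⁻ β, F (α ++ β : List X) ∂tupleMeasure ν j := by fun_prop
  simp only [lintegral_poisson, lintegral_tupleMeasure_add μ ν _ hF]
  simp_rw [lintegral_tsum fun j => ((inner_meas j).const_mul _).aemeasurable,
    lintegral_const_mul _ (inner_meas _), ← ENNReal.tsum_mul_left]
  rw [← ENNReal.tsum_prod, ← Finset.HasAntidiagonal.sigmaAntidiagonalEquivProd.tsum_eq,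
    ENNReal.tsum_sigma']
  refine tsum_congr fun n => ?_
  rw [tsum_fintype, Finset.mul_sum, ← Finset.sum_coe_sort]
  refine Finset.sum_congr rfl fun ⟨(i, j), hij⟩ _ => ?_
  obtain rfl := Finset.HasAntidiagonal.mem_antidiagonal.1 hij
  rw [← mul_assoc, ← mul_assoc, inv_factorial_mul_choose]
  rfl

theorem tupleMeasure_map (μ : Measure X) [SFinite μ] {f : X → Y} (hf : Measurable f) (n : ℕ) :
    tupleMeasure (μ.map f) n = (tupleMeasure μ n).map (List.map f) := by
  have hmap := measurable_list_map hf
  induction n with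
  | zero => simp only [tupleMeasure, Measure.map_dirac' hmap, List.map_nil]
  | succ n ih =>
    rw [tupleMeasure, ih, Measure.map_prod_map _ _ hf hmap, tupleMeasure,
      Measure.map_map (by fun_prop) (hf.prodMap hmap), Measure.map_map hmap (by fun_prop)]
    rfl

theorem poisson_map (μ : Measure X) [SFinite μ] {f : X → Y} (hf : Measurable f) :
    poisson (μ.map f) = (poisson μ).map (List.map f) := by
  simp only [poisson, tupleMeasure_map μ hf, Measure.map_sum (measurable_list_map hf).aemeasurable,
    Measure.map_smul]

theorem lintegral_tupleMeasure_prod (μ : Measure X) [SFinite μ] (n : ℕ) {q : X → ℝ≥0∞}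
    (hq : Measurable q) :
    ∫⁻ l, (l.map q).prod ∂tupleMeasure μ n = (∫⁻ x, q x ∂μ) ^ n := by
  have prod_meas : Measurable fun l : List X => (l.map q).prod := by
    have coe_prod_meas : Measurable fun l : List X => ((l : Multiset X).map q).prod := by fun_prop
    simpa only [Multiset.map_coe, Multiset.prod_coe] using coe_prod_meas
  induction n with
  | zero => rw [lintegral_tupleMeasure_zero _ prod_meas, List.map_nil, List.prod_nil, pow_zero]
  | succ n ih =>
    rw [lintegral_tupleMeasure_succ _ _ prod_meas]
    simp_rw [List.map_cons, List.prod_cons, lintegral_const_mul _ prod_meas, ih]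
    rw [lintegral_mul_const _ hq, pow_succ']

theorem tsum_inv_factorial_mul_pow_lt_top {a : ℝ≥0∞} (ha : a ≠ ∞) :
    ∑' n : ℕ, (n.factorial : ℝ≥0∞)⁻¹ * a ^ n < ∞ := by
  lift a to NNReal using ha
  have summable : Summable fun n : ℕ => (n.factorial : NNReal)⁻¹ * a ^ n := by
    rw [← NNReal.summable_coe]
    exact (Real.summable_pow_div_factorial a).congr fun n => by push_cast; rw [div_eq_inv_mul]
  refine lt_of_eq_of_lt (tsum_congr fun n => ?_)
    (ENNReal.tsum_coe_ne_top_iff_summable.2 summable).lt_top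
  rw [ENNReal.coe_mul, ENNReal.coe_inv (by exact_mod_cast Nat.factorial_ne_zero n),
    ENNReal.coe_natCast, ENNReal.coe_pow]

theorem lintegral_poisson_prod_lt_top (μ : Measure X) [SFinite μ] {q : X → ℝ≥0∞} (hq : Measurable q)
    (h : ∫⁻ x, q x ∂μ ≠ ∞) :
    ∫⁻ l : List X, ((l : Multiset X).map q).prod ∂poisson μ < ∞ := by
  simp only [Multiset.map_coe, Multiset.prod_coe, lintegral_poisson,
    lintegral_tupleMeasure_prod μ _ hq]
  exact tsum_inv_factorial_mul_pow_lt_top h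

end Poisson

section Labels

variable {X Y A B C : Type*}

/-- Change of the label of a point. -/
abbrev relabel (i : B → A) : X × B → X × A := Prod.map id i

/-- The union of two labelled configurations. -/
def labelledUnion (e : B ⊕ C ≃ A) (β : Multiset (X × B)) (γ : Multiset (X × C)) :
    Multiset (X × A) :=
  β.map (relabel fun b => e (Sum.inl b)) + γ.map (relabel fun c => e (Sum.inr c))

theorem prod_map_labelledUnion {M : Type*} [CommMonoid M] (e : B ⊕ C ≃ A) (β : Multiset (X × B))
    (γ : Multiset (X × C)) (q : X × A → M) :
    ((labelledUnion e β γ).map q).prod =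
      (β.map fun p => q (p.1, e (Sum.inl p.2))).prod *
        (γ.map fun p => q (p.1, e (Sum.inr p.2))).prod := by
  simp only [labelledUnion, Multiset.map_add, Multiset.prod_add, Multiset.map_map]
  rfl

/-- The points whose label survives a partial change of labels. -/
def filterLabel (c : A → Option B) (ζ : Multiset (X × A)) : Multiset (X × B) :=
  ζ.filterMap fun p => (c p.2).map fun b => (p.1, b)

theorem filterLabel_map_relabel (c : A → Option B) (i : C → A) (ζ : Multiset (X × C)) :
    filterLabel c (ζ.map (relabel i)) = filterLabel (fun a => c (i a)) ζ :=
  Multiset.filterMap_map _ _ _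

theorem filterLabel_some (i : A → B) (ζ : Multiset (X × A)) :
    filterLabel (fun a => some (i a)) ζ = ζ.map (relabel i) := by
  rw [← Multiset.filterMap_eq_map]
  rfl

theorem filterLabel_none (ζ : Multiset (X × A)) :
    filterLabel (fun _ => (none : Option B)) ζ = 0 := by
  induction ζ using Multiset.induction with
  | empty => rfl
  | cons p ζ ih => exact (Multiset.filterMap_cons_none _ _ rfl).trans ih

theorem filterLabel_labelledUnion {A' : Type*} (c : A → Option A') (e : B ⊕ C ≃ A)
    (β : Multiset (X × B)) (γ : Multiset (X × C)) :
    filterLabel c (labelledUnion e β γ) =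
      filterLabel (fun b => c (e (Sum.inl b))) β + filterLabel (fun b => c (e (Sum.inr b))) γ := by
  exact (Multiset.filterMap_add _ _ _).trans
    (congrArg₂ _ (filterLabel_map_relabel _ _ β) (filterLabel_map_relabel _ _ γ))

variable [MeasurableSpace X] [MeasurableSpace A] [MeasurableSpace B] [MeasurableSpace C]

@[fun_prop]
theorem measurable_relabel [Finite B] [MeasurableSingletonClass B] (i : B → A) :
    Measurable (relabel (X := X) i) :=
  measurable_id.prodMap (measurable_of_finite i)

theorem measurable_filterLabel [Countable A] [MeasurableSingletonClass A] (c : A → Option B) :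
    Measurable (filterLabel (X := X) c) := by
  refine measurable_multiset_iff.2 (measurable_multiset_coe
    (f := List.filterMap fun p : X × A => (c p.2).map fun b => (p.1, b)) ?_)
  refine measurable_list_of_cons (fun q => ((c q.1.2).elim q.2.2 fun b => (q.1.1, b) :: q.2.2))
    ?_ fun p l => ?_
  · have uncurried : Measurable fun q : (X × List (X × A) × List (X × B)) × A =>
        (c q.2).elim q.1.2.2 fun b => (q.1.1, b) :: q.1.2.2 := by
      refine measurable_from_prod_countable_left fun a => ?_
      cases hc : c a <;> simp only [hc, Option.elim_none, Option.elim_some] <;> fun_prop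
    exact uncurried.fun_comp (f := fun q : (X × A) × List (X × A) × List (X × B) =>
      ((q.1.1, q.2), q.1.2)) (by fun_prop)
  · cases hc : c p.2 <;>
      simp only [List.filterMap_cons, hc, Option.map_none, Option.map_some, Option.elim_none,
        Option.elim_some]

@[fun_prop]
theorem measurable_labelledUnion [Finite B] [Finite C] [MeasurableSingletonClass B]
    [MeasurableSingletonClass C] [MeasurableSpace Y] (e : B ⊕ C ≃ A) {f : Y → List (X × B)}
    {g : Y → List (X × C)} (hf : Measurable f) (hg : Measurable g) :
    Measurable fun y => labelledUnion e (f y : Multiset (X × B)) (g y : Multiset (X × C)) := by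
  have union_eq (y : Y) : labelledUnion e (f y : Multiset (X × B)) (g y : Multiset (X × C)) =
      ((f y).map (relabel fun b => e (Sum.inl b)) ++
        (g y).map (relabel fun c => e (Sum.inr c)) : List (X × A)) := rfl
  simp only [union_eq]
  fun_prop

/-- The measure `μ` on every copy of `X` in the space `X × C` of labelled points. -/
abbrev labelled (μ : Measure X) (C : Type*) [MeasurableSpace C] : Measure (X × C) :=
  μ.prod Measure.count

theorem lintegral_labelled [Fintype C] [MeasurableSingletonClass C] (μ : Measure X)
    [SFinite μ] {F : X × C → ℝ≥0∞} (hF : Measurable F) :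
    ∫⁻ p, F p ∂labelled μ C = ∫⁻ x, ∑ c, F (x, c) ∂μ := by
  simp only [lintegral_prod _ hF.aemeasurable, lintegral_count, tsum_fintype]

variable [Finite A] [Finite B] [Finite C] [MeasurableSingletonClass A]
  [MeasurableSingletonClass B] [MeasurableSingletonClass C]

theorem labelled_eq_add (μ : Measure X) [SFinite μ] (e : B ⊕ C ≃ A) :
    labelled μ A = (labelled μ B).map (relabel fun b => e (Sum.inl b)) +
      (labelled μ C).map (relabel fun c => e (Sum.inr c)) := by
  have := Fintype.ofFinite A
  have := Fintype.ofFinite B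
  have := Fintype.ofFinite C
  refine Measure.ext_of_lintegral _ fun F hF => ?_
  rw [lintegral_add_measure, lintegral_map hF (by fun_prop), lintegral_map hF (by fun_prop),
    lintegral_labelled μ hF, lintegral_labelled μ (by fun_prop),
    lintegral_labelled μ (by fun_prop), ← lintegral_add_left (by fun_prop)]
  refine lintegral_congr fun x => ?_
  rw [← e.sum_comp, Fintype.sum_sum_type]
  rfl

theorem map_poisson_labelled (μ : Measure X) [SFinite μ] (e : B ⊕ C ≃ A) :
    (poisson (labelled μ A)).map (fun l : List (X × A) => (l : Multiset (X × A))) =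
      ((poisson (labelled μ B)).prod (poisson (labelled μ C))).map
        fun p => labelledUnion e p.1 p.2 := by
  have hB := measurable_list_map (measurable_relabel (X := X) fun b => e (Sum.inl b))
  have hC := measurable_list_map (measurable_relabel (X := X) fun c => e (Sum.inr c))
  refine Measure.ext_of_lintegral _ fun F hF => ?_
  rw [lintegral_map hF (by fun_prop), lintegral_map hF (by fun_prop),
    lintegral_prod _ (Measurable.aemeasurable (by fun_prop)), labelled_eq_add μ e,
    lintegral_poisson_add _ _ hF, poisson_map _ (by fun_prop),
    poisson_map _ (by fun_prop), lintegral_map (by fun_prop) hB]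
  refine lintegral_congr fun α => ?_
  rw [lintegral_map (by fun_prop) hC]
  rfl

theorem lintegral_poisson_labelled (μ : Measure X) [SFinite μ] (e : B ⊕ C ≃ A)
    {F : Multiset (X × A) → ℝ≥0∞} (hF : Measurable F) :
    ∫⁻ l, F l ∂poisson (labelled μ A) = ∫⁻ β, ∫⁻ γ, F (labelledUnion e β γ)
      ∂poisson (labelled μ C) ∂poisson (labelled μ B) := by
  rw [← lintegral_map hF (by fun_prop), map_poisson_labelled μ e,
    lintegral_map hF (by fun_prop), lintegral_prod _ (Measurable.aemeasurable (by fun_prop))]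

theorem integrable_poisson_labelled_iff (μ : Measure X) [SFinite μ] (e : B ⊕ C ≃ A)
    {F : Multiset (X × A) → ℂ} (hF : Measurable F) :
    Integrable (fun l : List (X × A) => F l) (poisson (labelled μ A)) ↔
      Integrable (fun p => F (labelledUnion e p.1 p.2))
        ((poisson (labelled μ B)).prod (poisson (labelled μ C))) := by
  have h := integrable_map_measure (μ := poisson (labelled μ A)) (f := fun l => (l : Multiset _))
    hF.aestronglyMeasurable (by fun_prop)
  rw [map_poisson_labelled μ e, integrable_map_measure hF.aestronglyMeasurable
    (Measurable.aemeasurable (by fun_prop))] at h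
  exact h.symm

theorem integral_poisson_labelled (μ : Measure X) [SFinite μ] (e : B ⊕ C ≃ A)
    {F : Multiset (X × A) → ℂ} (hF : Measurable F) :
    ∫ l : List (X × A), F l ∂poisson (labelled μ A) = ∫ p, F (labelledUnion e p.1 p.2)
      ∂(poisson (labelled μ B)).prod (poisson (labelled μ C)) := by
  rw [← integral_map (φ := fun l : List (X × A) => (l : Multiset (X × A)))
      (by fun_prop) hF.aestronglyMeasurable,
    map_poisson_labelled μ e, integral_map (Measurable.aemeasurable (by fun_prop))
      hF.aestronglyMeasurable]

end Labels

/-! ### Sums over labellings -/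

section LabelSum

variable {X Y C : Type*} [Fintype C] {M N : Type*} [AddCommMonoid M] [AddCommMonoid N]

/-- The sum of `F` over all ways to attach labels in `C` to the points of a list. -/
def labelSum (F : List (X × C) → M) : List X → M
  | [] => F []
  | x :: l => ∑ c, labelSum (fun t => F ((x, c) :: t)) l

theorem labelSum_congr {F G : List (X × C) → M} {l : List X}
    (h : ∀ t : List (X × C), t.map Prod.fst = l → F t = G t) : labelSum F l = labelSum G l := by
  induction l generalizing F G with
  | nil => exact h [] rfl
  | cons x l ih =>
    exact Finset.sum_congr rfl fun c _ => ih fun t ht => h _ (by rw [List.map_cons, ht])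

theorem map_labelSum (φ : M →+ N) (F : List (X × C) → M) (l : List X) :
    φ (labelSum F l) = labelSum (fun t => φ (F t)) l := by
  induction l generalizing F with
  | nil => rfl
  | cons x l ih => simp only [labelSum, map_sum, ih]

theorem labelSum_map (f : X → Y) (F : List (Y × C) → M) (l : List X) :
    labelSum F (l.map f) = labelSum (fun t => F (t.map (Prod.map f id))) l := by
  induction l generalizing F with
  | nil => rfl
  | cons x l ih =>
    simp only [List.map_cons, labelSum, ih]
    rfl

theorem labelSum_perm (F : Multiset (X × C) → M) {l l' : List X} (h : l.Perm l') :
    labelSum (fun t : List (X × C) => F t) l = labelSum (fun t : List (X × C) => F t) l' := by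
  induction h generalizing F with
  | nil => rfl
  | cons x _ ih => exact Finset.sum_congr rfl fun c _ => ih fun m => F ((x, c) ::ₘ m)
  | swap x y l =>
    simp only [labelSum]
    rw [Finset.sum_comm]
    simp only [← Multiset.cons_coe, Multiset.cons_swap (y, _) (x, _)]
  | trans _ _ ih₁ ih₂ => rw [ih₁, ih₂]

/-- The sum of `F` over all ways to attach labels in `C` to the points of a multiset. -/
def multisetLabelSum (F : Multiset (X × C) → M) (m : Multiset X) : M :=
  Quotient.liftOn m (fun l => labelSum (fun t : List (X × C) => F t) l) fun _ _ => labelSum_perm F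

@[simp]
theorem multisetLabelSum_coe (F : Multiset (X × C) → M) (l : List X) :
    multisetLabelSum F (l : Multiset X) = labelSum (fun t : List (X × C) => F t) l := rfl

theorem labelSum_const_mul {R : Type*} [NonUnitalNonAssocSemiring R] (a : R)
    (F : List (X × C) → R) (l : List X) :
    labelSum (fun t => a * F t) l = a * labelSum F l :=
  (map_labelSum (AddMonoidHom.mulLeft a) F l).symm

theorem mul_labelSum {R : Type*} [NonUnitalNonAssocSemiring R] (F : List (X × C) → R)
    (G : List X → R) (l : List X) :
    G l * labelSum F l = labelSum (fun t => G (t.map Prod.fst) * F t) l := by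
  rw [← labelSum_const_mul]
  exact labelSum_congr fun t ht => by rw [ht]

theorem labelSum_mono {F G : List (X × C) → ℝ≥0∞} (h : ∀ t, F t ≤ G t) (l : List X) :
    labelSum F l ≤ labelSum G l := by
  induction l generalizing F G with
  | nil => exact h []
  | cons x l ih => exact Finset.sum_le_sum fun c _ => ih fun t => h _

theorem labelSum_one (l : List X) :
    labelSum (fun _ : List (X × C) => (1 : ℝ≥0∞)) l = (Fintype.card C : ℝ≥0∞) ^ l.length := by
  induction l with
  | nil => rfl
  | cons x l ih =>
    simp only [labelSum, ih, Finset.sum_const, Finset.card_univ, nsmul_eq_mul, List.length_cons,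
      pow_succ']

theorem enorm_labelSum_le (F : List (X × C) → ℂ) (l : List X) :
    ‖labelSum F l‖ₑ ≤ labelSum (fun t => ‖F t‖ₑ) l := by
  induction l generalizing F with
  | nil => exact le_rfl
  | cons x l ih =>
    exact (enorm_sum_le _ _).trans (Finset.sum_le_sum fun c _ => ih fun t => F ((x, c) :: t))

end LabelSum

section LabelKernel

universe u

variable {X Y : Type u} {C : Type*} [Fintype C] [MeasurableSpace X] [MeasurableSpace Y]
  [MeasurableSpace C]

theorem measurable_labelSum_prod {M : Type*} [AddCommMonoid M] [MeasurableSpace M]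
    [MeasurableAdd₂ M] {F : Y × List (X × C) → M} (hF : Measurable F) :
    Measurable fun p : Y × List X => labelSum (fun t => F (p.1, t)) p.2 := by
  refine measurable_prod_list_iff.2 fun n => ?_
  induction n generalizing Y with
  | zero =>
    simp only [List.ofFn_zero, labelSum]
    fun_prop
  | succ n ih =>
    simp only [List.ofFn_succ, labelSum]
    refine Finset.measurable_fun_sum _ fun c _ => ?_
    have head_meas : Measurable fun p : (Y × X) × List (X × C) =>
        F (p.1.1, (p.1.2, c) :: p.2) := by fun_prop
    exact (ih head_meas).fun_comp
      (f := fun p : Y × (Fin (n + 1) → X) => ((p.1, p.2 0), fun i : Fin n => p.2 i.succ))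
      (by fun_prop)

theorem measurable_labelSum {M : Type*} [AddCommMonoid M] [MeasurableSpace M]
    [MeasurableAdd₂ M] {F : List (X × C) → M} (hF : Measurable F) :
    Measurable fun l : List X => labelSum F l :=
  (measurable_labelSum_prod (Y := PUnit) (F := fun p => F p.2) (hF.comp measurable_snd)).comp
    (measurable_const.prodMk measurable_id : Measurable fun l : List X => (PUnit.unit, l))

theorem measurable_multisetLabelSum {M : Type*} [AddCommMonoid M] [MeasurableSpace M]
    [MeasurableAdd₂ M] {F : Multiset (X × C) → M} (hF : Measurable F) :
    Measurable (multisetLabelSum F) :=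
  measurable_labelSum (measurable_multiset_iff.1 hF)

theorem lintegral_labelSum_dirac {F : List (X × C) → ℝ≥0∞} (hF : Measurable F)
    (m : List (X × C) → List (X × C)) (l : List X) :
    ∫⁻ t, F t ∂(labelSum (fun t => Measure.dirac (m t)) l : Measure (List (X × C))) =
      labelSum (fun t => F (m t)) l := by
  induction l generalizing m with
  | nil => exact lintegral_dirac' _ hF
  | cons x l ih =>
    simp only [labelSum, lintegral_finsetSum_measure, ih]

/-- The kernel which attaches labels to the points of a list, each labelling having mass one. -/
def labelKernel (X : Type u) (C : Type*) [Fintype C] [MeasurableSpace X] [MeasurableSpace C] :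
    ProbabilityTheory.Kernel (List X) (List (X × C)) where
  toFun l := labelSum (fun t => Measure.dirac t) l
  measurable' := by
    refine Measure.measurable_of_measurable_coe _ fun S hS => ?_
    have indicator_meas : Measurable (S.indicator fun _ : List (X × C) => (1 : ℝ≥0∞)) :=
      measurable_const.indicator hS
    convert measurable_labelSum indicator_meas using 2 with l
    rw [← lintegral_labelSum_dirac indicator_meas fun t => t, lintegral_indicator_const hS, one_mul]

theorem lintegral_labelKernel {F : List (X × C) → ℝ≥0∞} (hF : Measurable F) (l : List X) :
    ∫⁻ t, F t ∂labelKernel X C l = labelSum F l :=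
  lintegral_labelSum_dirac hF id l

theorem integrable_labelSum_dirac {F : List (X × C) → ℂ} (hF : Measurable F)
    (m : List (X × C) → List (X × C)) (l : List X) :
    Integrable F (labelSum (fun t => Measure.dirac (m t)) l : Measure (List (X × C))) := by
  induction l generalizing m with
  | nil =>
    refine ⟨hF.aestronglyMeasurable, ?_⟩
    rw [labelSum, hasFiniteIntegral_iff_enorm, lintegral_dirac' _ hF.enorm]
    exact enorm_lt_top
  | cons x l ih => exact integrable_finsetSum_measure.2 fun c _ => ih _

theorem integral_labelKernel {F : List (X × C) → ℂ} (hF : Measurable F) (l : List X) :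
    ∫ t, F t ∂labelKernel X C l = labelSum F l := by
  suffices ∀ m : List (X × C) → List (X × C),
      ∫ t, F t ∂(labelSum (fun t => Measure.dirac (m t)) l : Measure (List (X × C))) =
        labelSum (fun t => F (m t)) l from this id
  intro m
  induction l generalizing m with
  | nil => exact integral_dirac' _ _ hF.stronglyMeasurable
  | cons x l ih =>
    rw [labelSum, integral_finsetSum_measure fun c _ => integrable_labelSum_dirac hF _ l]
    exact Finset.sum_congr rfl fun c _ => ih _

variable [MeasurableSingletonClass C]

theorem lintegral_tupleMeasure_labelSum (μ : Measure X) [SFinite μ] (n : ℕ)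
    {F : List (X × C) → ℝ≥0∞} (hF : Measurable F) :
    ∫⁻ t, F t ∂tupleMeasure (labelled μ C) n = ∫⁻ l, labelSum F l ∂tupleMeasure μ n := by
  induction n generalizing F with
  | zero =>
    rw [lintegral_tupleMeasure_zero _ hF, lintegral_tupleMeasure_zero _ (measurable_labelSum hF)]
    rfl
  | succ n ih =>
    have cons_meas (x : X) (c : C) : Measurable fun t : List (X × C) => F ((x, c) :: t) := by
      fun_prop
    rw [lintegral_tupleMeasure_succ _ _ hF,
      lintegral_tupleMeasure_succ _ _ (measurable_labelSum hF), lintegral_labelled μ (by fun_prop)]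
    refine lintegral_congr fun x => ?_
    simp only [labelSum]
    rw [lintegral_finsetSum _ fun c _ => measurable_labelSum (cons_meas x c)]
    exact Finset.sum_congr rfl fun c _ => ih (cons_meas x c)

theorem lintegral_poisson_labelSum (μ : Measure X) [SFinite μ]
    {F : List (X × C) → ℝ≥0∞} (hF : Measurable F) :
    ∫⁻ t, F t ∂poisson (labelled μ C) = ∫⁻ l, labelSum F l ∂poisson μ := by
  simp only [lintegral_poisson, lintegral_tupleMeasure_labelSum μ _ hF]

theorem poisson_labelled_eq_bind (μ : Measure X) [SFinite μ] :
    poisson (labelled μ C) = (poisson μ).bind (labelKernel X C) := by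
  refine Measure.ext_of_lintegral _ fun F hF => ?_
  rw [Measure.lintegral_bind (labelKernel X C).measurable.aemeasurable hF.aemeasurable,
    lintegral_poisson_labelSum μ hF]
  simp only [lintegral_labelKernel hF]

theorem integrable_poisson_labelSum (μ : Measure X) [SFinite μ] {F : List (X × C) → ℂ}
    (hF : Measurable F) (hint : Integrable F (poisson (labelled μ C))) :
    Integrable (fun l => labelSum F l) (poisson μ) := by
  refine ⟨(measurable_labelSum hF).aestronglyMeasurable, ?_⟩
  rw [hasFiniteIntegral_iff_enorm]
  refine (lintegral_mono fun l => enorm_labelSum_le F l).trans_lt ?_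
  rw [← lintegral_poisson_labelSum μ hF.enorm]
  exact hasFiniteIntegral_iff_enorm.1 hint.2

theorem integral_poisson_labelSum (μ : Measure X) [SFinite μ] {F : List (X × C) → ℂ}
    (hF : Measurable F) (hint : Integrable F (poisson (labelled μ C))) :
    ∫ t, F t ∂poisson (labelled μ C) = ∫ l, labelSum F l ∂poisson μ := by
  have integral_comp := ProbabilityTheory.Kernel.integral_comp (η := labelKernel X C)
    (κ := ProbabilityTheory.Kernel.const Unit (poisson μ)) (a := ()) (f := F)
  rw [ProbabilityTheory.Kernel.comp_apply, ProbabilityTheory.Kernel.const_apply,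
    ← poisson_labelled_eq_bind] at integral_comp
  rw [integral_comp hint]
  simp only [integral_labelKernel hF]

end LabelKernel

/-! ### Ordered configurations -/

section Simplex

theorem tupleMeasure_eq_map_pi {X : Type*} [MeasurableSpace X] (μ : Measure X) [SigmaFinite μ]
    (n : ℕ) :
    tupleMeasure μ n = (Measure.pi fun _ : Fin n => μ).map fun x => List.ofFn x := by
  induction n with
  | zero =>
    rw [Measure.pi_of_empty (fun _ : Fin 0 => μ), Measure.map_dirac' (measurable_ofFn 0),
      List.ofFn_zero, tupleMeasure]
  | succ n ih =>
    have split_head := (measurePreserving_piFinSuccAbove (fun _ : Fin (n + 1) => μ) 0).symm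
    have ofFn_meas := measurable_ofFn (X := X) n
    refine Measure.ext_of_lintegral _ fun F hF => ?_
    have cons_meas (x : X) : Measurable fun l : List X => F (x :: l) := by fun_prop
    rw [lintegral_tupleMeasure_succ _ _ hF, ih, lintegral_map hF (measurable_ofFn _),
      ← split_head.map_eq, lintegral_map (hF.fun_comp (measurable_ofFn _)) split_head.measurable]
    simp_rw [lintegral_map (cons_meas _) ofFn_meas]
    rw [← lintegral_prod (fun p : X × (Fin n → X) => F (p.1 :: List.ofFn p.2)) (by fun_prop)]
    refine lintegral_congr fun p => congrArg F ?_
    simp only [MeasurableEquiv.piFinSuccAbove_symm_apply, Fin.insertNthEquiv, Equiv.coe_fn_mk,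
      Fin.insertNth_zero', List.ofFn_cons]

theorem lintegral_poisson_pi {X : Type*} [MeasurableSpace X] (μ : Measure X) [SigmaFinite μ]
    {F : List X → ℝ≥0∞} (hF : Measurable F) :
    ∫⁻ l, F l ∂poisson μ = ∑' n : ℕ, (n.factorial : ℝ≥0∞)⁻¹ *
      ∫⁻ x : Fin n → X, F (List.ofFn x) ∂Measure.pi fun _ => μ := by
  simp only [lintegral_poisson, tupleMeasure_eq_map_pi, lintegral_map hF (measurable_ofFn _)]

theorem ae_poisson_iff {X : Type*} [MeasurableSpace X] (μ : Measure X) [SigmaFinite μ]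
    {p : List X → Prop} (hp : MeasurableSet {l | p l}) :
    (∀ᵐ l ∂poisson μ, p l) ↔
      ∀ n, ∀ᵐ x : Fin n → X ∂Measure.pi fun _ => μ, p (List.ofFn x) := by
  rw [poisson, Measure.ae_sum_iff]
  refine forall_congr' fun n => ?_
  rw [Measure.ae_ennreal_smul_measure_iff (ENNReal.inv_ne_zero.2 (ENNReal.natCast_ne_top _)),
    tupleMeasure_eq_map_pi, ae_map_iff (measurable_ofFn n).aemeasurable hp]

theorem inv_factorial_mul_factorial (n : ℕ) : (n.factorial : ℝ≥0∞)⁻¹ * n.factorial = 1 :=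
  ENNReal.inv_mul_cancel (by exact_mod_cast Nat.factorial_ne_zero n) (ENNReal.natCast_ne_top _)

section Nodup

variable {X : Type*} [MeasurableSpace X] [MeasurableEq X]

theorem measurableSet_nodup : MeasurableSet {l : List X | l.Nodup} := by
  refine measurableSet_list_iff.2 fun n => ?_
  simp only [Set.mem_ofPred_eq, List.nodup_ofFn, Function.Injective]
  measurability

theorem ae_nodup_tupleMeasure (μ : Measure X) [SFinite μ] [NullSingletonClass μ] (n : ℕ) :
    ∀ᵐ l ∂tupleMeasure μ n, l.Nodup := by
  induction n with
  | zero =>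
    rw [tupleMeasure, ae_dirac_iff measurableSet_nodup]
    exact List.nodup_nil
  | succ n ih =>
    have cons_nodup_meas : MeasurableSet {p : X × List X | (p.1 :: p.2).Nodup} :=
      measurable_list_cons measurable_fst measurable_snd measurableSet_nodup
    rw [tupleMeasure, ae_map_iff (by fun_prop) measurableSet_nodup,
      Measure.ae_prod_iff_ae_ae cons_nodup_meas, Measure.ae_ae_comm cons_nodup_meas]
    filter_upwards [ih] with l hl
    filter_upwards [(List.finite_toSet l).countable.ae_notMem μ] with x hx
    exact List.nodup_cons.2 ⟨hx, hl⟩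

end Nodup

section StrictMono

variable {X : Type*} [LinearOrder X]

theorem measurableSet_strictMono [TopologicalSpace X] [OrderClosedTopology X]
    [SecondCountableTopology X] [MeasurableSpace X] [OpensMeasurableSpace X] (n : ℕ) :
    MeasurableSet {x : Fin n → X | StrictMono x} := by
  simp only [StrictMono, Set.ofPred_forall]
  exact MeasurableSet.iInter fun i => MeasurableSet.iInter fun j => MeasurableSet.iInter fun _ =>
    measurableSet_lt (measurable_pi_apply i) (measurable_pi_apply j)

theorem eq_of_strictMono_comp_perm {n : ℕ} {x : Fin n → X} {σ τ : Equiv.Perm (Fin n)}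
    (hσ : StrictMono (x ∘ σ)) (hτ : StrictMono (x ∘ τ)) : σ = τ := by
  have x_injective : Function.Injective x := σ.injective_comp x |>.1 hσ.injective
  have comp_eq : x ∘ σ = x ∘ τ := Tuple.unique_monotone hσ.monotone hτ.monotone
  exact Equiv.ext fun i => x_injective (congrFun comp_eq i)

end StrictMono

variable (I : Set ℝ)

/-- The measure `dx₁ ⋯ dx_n` on ordered configurations. -/
def orderedMeasure : Measure (List ℝ) :=
  Measure.sum fun n : ℕ =>
    ((configMeasure I n).restrict {x | StrictMono x}).map fun x => List.ofFn x

theorem iUnion_strictMono_comp_perm_ae_eq_univ (n : ℕ) :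
    (⋃ σ : Equiv.Perm (Fin n), {x : Fin n → ℝ | StrictMono (x ∘ σ)}) =ᵐ[configMeasure I n]
      Set.univ := by
  rw [Filter.eventuallyEq_univ]
  have ae_nodup := ae_nodup_tupleMeasure (volume.restrict I) n
  rw [tupleMeasure_eq_map_pi, ae_map_iff (measurable_ofFn n).aemeasurable measurableSet_nodup]
    at ae_nodup
  filter_upwards [ae_nodup] with x hx
  rw [List.nodup_ofFn] at hx
  exact Set.mem_iUnion.2 ⟨Tuple.sort x,
    (Tuple.monotone_sort x).strictMono_of_injective (hx.comp (Tuple.sort x).injective)⟩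

theorem lintegral_configMeasure_eq_factorial_mul (n : ℕ) {F : Multiset ℝ → ℝ≥0∞}
    (hF : Measurable F) :
    ∫⁻ x : Fin n → ℝ, F (List.ofFn x) ∂configMeasure I n =
      n.factorial * ∫⁻ x in {x : Fin n → ℝ | StrictMono x}, F (List.ofFn x)
        ∂configMeasure I n := by
  have chamber_eq (σ : Equiv.Perm (Fin n)) :
      ∫⁻ x in {x : Fin n → ℝ | StrictMono (x ∘ σ)}, F (List.ofFn x) ∂configMeasure I n =
        ∫⁻ x in {x : Fin n → ℝ | StrictMono x}, F (List.ofFn x) ∂configMeasure I n := by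
    have ofFn_meas := measurable_ofFn (X := ℝ) n
    rw [← (measurePreserving_perm I σ).setLIntegral_comp_preimage (measurableSet_strictMono n)
      (by fun_prop)]
    refine lintegral_congr fun x => ?_
    rw [Multiset.coe_eq_coe.2 (Equiv.Perm.ofFn_comp_perm σ x)]
  rw [← setLIntegral_univ, ← setLIntegral_congr (iUnion_strictMono_comp_perm_ae_eq_univ I n),
    lintegral_iUnion, tsum_fintype]
  · simp only [chamber_eq, Finset.sum_const, Finset.card_univ, Fintype.card_perm, Fintype.card_fin,
      nsmul_eq_mul]
  · exact fun σ => (measurePreserving_perm I σ).measurable (measurableSet_strictMono n)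
  · exact fun σ τ hστ =>
      Set.disjoint_left.2 fun x hx hx' => hστ (eq_of_strictMono_comp_perm hx hx')

theorem map_poisson_eq_map_orderedMeasure :
    (poisson (volume.restrict I)).map (fun l : List ℝ => (l : Multiset ℝ)) =
      (orderedMeasure I).map fun l : List ℝ => (l : Multiset ℝ) := by
  refine Measure.ext_of_lintegral _ fun F hF => ?_
  rw [lintegral_map hF (by fun_prop), lintegral_map hF (by fun_prop),
    lintegral_poisson_pi _ (by fun_prop), orderedMeasure, lintegral_sum_measure]
  refine tsum_congr fun n => ?_
  rw [lintegral_map (by fun_prop) (measurable_ofFn n),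
    lintegral_configMeasure_eq_factorial_mul I n hF, ← mul_assoc, inv_factorial_mul_factorial,
    one_mul]

variable {F : Multiset ℝ → ℂ}

theorem integrable_poisson_iff_orderedMeasure (hF : Measurable F) :
    Integrable (fun l : List ℝ => F l) (poisson (volume.restrict I)) ↔
      Integrable (fun l : List ℝ => F l) (orderedMeasure I) := by
  have integrable_map_coe_iff (ν : Measure (List ℝ)) :=
    integrable_map_measure (μ := ν) (f := fun l : List ℝ => (l : Multiset ℝ))
      hF.aestronglyMeasurable (by fun_prop)
  exact (integrable_map_coe_iff _).symm.trans
    (map_poisson_eq_map_orderedMeasure I ▸ integrable_map_coe_iff _)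

theorem integral_poisson_eq_orderedMeasure (hF : Measurable F) :
    ∫ l : List ℝ, F l ∂poisson (volume.restrict I) = ∫ l : List ℝ, F l ∂orderedMeasure I := by
  rw [← integral_map (φ := fun l : List ℝ => (l : Multiset ℝ)) (by fun_prop)
      hF.aestronglyMeasurable,
    map_poisson_eq_map_orderedMeasure I, integral_map (by fun_prop) hF.aestronglyMeasurable]

theorem integrableOn_strictMono_of_integrable_poisson (hF : Measurable F)
    (hint : Integrable (fun l : List ℝ => F l) (poisson (volume.restrict I))) (n : ℕ) :
    IntegrableOn (fun x : Fin n → ℝ => F (List.ofFn x)) {x | StrictMono x} (configMeasure I n) :=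
  (integrable_map_measure (g := fun l : List ℝ => F l) (Measurable.aestronglyMeasurable
      (by fun_prop)) (measurable_ofFn n).aemeasurable).1 <|
    ((integrable_poisson_iff_orderedMeasure I hF).1 hint).mono_measure (Measure.le_sum _ n)

theorem hasSum_integral_strictMono (hF : Measurable F)
    (hint : Integrable (fun l : List ℝ => F l) (poisson (volume.restrict I))) :
    HasSum (fun n : ℕ => ∫ x : Fin n → ℝ in {x | StrictMono x}, F (List.ofFn x)
      ∂configMeasure I n) (∫ l : List ℝ, F l ∂poisson (volume.restrict I)) := by
  rw [integral_poisson_eq_orderedMeasure I hF]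
  refine (hasSum_integral_measure ((integrable_poisson_iff_orderedMeasure I hF).1 hint)).congr_fun
    fun n => ?_
  rw [integral_map (measurable_ofFn n).aemeasurable
    (Measurable.aestronglyMeasurable (f := fun l : List ℝ => F l) (by fun_prop))]

end Simplex

/-! ### Fock space vectors as functions of configurations -/

section SquareIntegrable

variable {α : Type*} [MeasurableSpace α] {μ : Measure α}

theorem enorm_sq_eq_lintegral (g : Lp ℂ 2 μ) : ‖g‖ₑ ^ 2 = ∫⁻ x, ‖g x‖ₑ ^ 2 ∂μ := by
  simpa only [Lp.enorm_def, NNReal.coe_ofNat, ENNReal.rpow_ofNat, ENNReal.coe_ofNat] using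
    eLpNorm_nnreal_pow_eq_lintegral (f := g) (μ := μ) (p := 2) two_ne_zero

theorem memLp_two_of_lintegral_sq_lt_top {k : α → ℂ} (hk : Measurable k)
    (hk2 : ∫⁻ x, ‖k x‖ₑ ^ 2 ∂μ < ∞) : MemLp k 2 μ :=
  ⟨hk.aestronglyMeasurable, (eLpNorm_lt_top_iff_lintegral_rpow_enorm_lt_top two_ne_zero
    ENNReal.ofNat_ne_top).2 (by simpa only [ENNReal.toReal_ofNat, ENNReal.rpow_ofNat] using hk2)⟩

theorem integrable_conj_mul_of_lintegral_sq_lt_top {g h : α → ℂ} (hg : Measurable g)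
    (hh : Measurable h) (hg2 : ∫⁻ x, ‖g x‖ₑ ^ 2 ∂μ < ∞) (hh2 : ∫⁻ x, ‖h x‖ₑ ^ 2 ∂μ < ∞) :
    Integrable (fun x => conj (g x) * h x) μ :=
  (memLp_two_of_lintegral_sq_lt_top hg hg2).star.integrable_mul
    (memLp_two_of_lintegral_sq_lt_top hh hh2)

theorem summable_pow_mul_norm_sq_iff {E : ℕ → Type*} [∀ n, SeminormedAddGroup (E n)] (c : NNReal)
    (v : ∀ n, E n) :
    (Summable fun n => (c : ℝ) ^ n * ‖v n‖ ^ 2) ↔ ∑' n, (c : ℝ≥0∞) ^ n * ‖v n‖ₑ ^ 2 < ∞ := by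
  have summable_iff :=
    NNReal.summable_coe (L := .unconditional ℕ) (f := fun n => c ^ n * ‖v n‖₊ ^ 2)
  rw [← ENNReal.tsum_coe_ne_top_iff_summable, ← lt_top_iff_ne_top] at summable_iff
  simpa only [NNReal.coe_mul, NNReal.coe_pow, coe_nnnorm, ENNReal.coe_mul, ENNReal.coe_pow,
    ← enorm_eq_nnnorm] using summable_iff

end SquareIntegrable

section Hat

variable {I : Set ℝ}

/-- `√(n!) φ_n (y₁, …, y_n)`, as a function of the list `y`. -/
def listWave (φ : WaveFn) (l : List ℝ) : ℂ :=
  (Real.sqrt (l.length.factorial) : ℂ) * φ l.length l.get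

theorem listWave_ofFn (φ : WaveFn) {n : ℕ} (x : Fin n → ℝ) :
    listWave φ (List.ofFn x) = (Real.sqrt (n.factorial) : ℂ) * φ n x := by
  have listWave_of_length_eq (l : List ℝ) (m : ℕ) (hm : l.length = m) :
      listWave φ l = (Real.sqrt (m.factorial) : ℂ) * φ m fun i => l.get (i.cast hm.symm) := by
    subst hm
    rfl
  rw [listWave_of_length_eq _ n List.length_ofFn]
  simp only [List.get_ofFn, Fin.cast_cast, Fin.cast_eq_self]

theorem measurable_listWave {φ : WaveFn} (hφ : ∀ n, Measurable (φ n)) :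
    Measurable (listWave φ) := by
  refine measurable_list_iff.2 fun n => ?_
  simp only [listWave_ofFn]
  exact (hφ n).const_mul _

theorem measurable_wave (f : Fock I) (n : ℕ) : Measurable (wave f n) :=
  (Lp.stronglyMeasurable _).measurable

/-- A Fock space vector as a function of finite configurations: the `n`-particle wave function
at the ordered points, times `√(n!)`. -/
def hat (f : Fock I) (m : Multiset ℝ) : ℂ := listWave (wave f) (m.sort (· ≤ ·))

@[fun_prop]
theorem measurable_hat (f : Fock I) : Measurable (hat f) :=
  (measurable_listWave (measurable_wave f)).comp
    (measurable_multiset_sort (measurableSet_le measurable_fst measurable_snd))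

theorem hat_of_pairwise (f : Fock I) {l : List ℝ} (hl : l.Pairwise (· < ·)) :
    hat f l = listWave (wave f) l := by
  have sort_eq : (l : Multiset ℝ).sort (· ≤ ·) = l :=
    (Multiset.coe_eq_coe.1 (Multiset.sort_eq (l : Multiset ℝ) (· ≤ ·))).eq_of_pairwise'
      (r := (· ≤ ·)) (Multiset.pairwise_sort _ _) (hl.imp le_of_lt)
  rw [hat, sort_eq]

theorem ae_wave_perm (f : Fock I) (n : ℕ) (σ : Equiv.Perm (Fin n)) :
    ∀ᵐ x ∂configMeasure I n, wave f n (x ∘ σ) = wave f n x := by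
  have f_symm := (f n).2
  simp only [sector, Submodule.mem_iInf, LinearMap.mem_eqLocus, LinearMap.id_coe, id_eq] at f_symm
  have coeFn_comp := Lp.coeFn_compMeasurePreserving (f n : Lp ℂ 2 (configMeasure I n))
    (measurePreserving_perm I σ)
  rw [show Lp.compMeasurePreserving _ (measurePreserving_perm I σ)
    (f n : Lp ℂ 2 (configMeasure I n)) = f n from f_symm σ] at coeFn_comp
  exact coeFn_comp.symm

theorem sort_coe_ofFn {n : ℕ} (x : Fin n → ℝ) :
    ((List.ofFn x : List ℝ) : Multiset ℝ).sort (· ≤ ·) = List.ofFn (x ∘ Tuple.sort x) := by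
  have perm : (((List.ofFn x : List ℝ) : Multiset ℝ).sort (· ≤ ·)).Perm
      (List.ofFn (x ∘ Tuple.sort x)) :=
    (Multiset.coe_eq_coe.1 (Multiset.sort_eq (List.ofFn x : Multiset ℝ) (· ≤ ·))).trans
      (Equiv.Perm.ofFn_comp_perm _ x).symm
  exact perm.eq_of_pairwise' (r := (· ≤ ·)) (Multiset.pairwise_sort _ _)
    (List.pairwise_ofFn.2 fun i j hij => Tuple.monotone_sort x hij.le)

theorem ae_hat_ofFn (f : Fock I) (n : ℕ) : ∀ᵐ x : Fin n → ℝ ∂configMeasure I n,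
    hat f (List.ofFn x) = (Real.sqrt (n.factorial) : ℂ) * wave f n x := by
  filter_upwards [ae_all_iff.2 (ae_wave_perm f n)] with x hx
  rw [hat, sort_coe_ofFn, listWave_ofFn, hx]

theorem enorm_sqrt_factorial_sq (n : ℕ) :
    ‖(Real.sqrt (n.factorial) : ℂ)‖ₑ ^ 2 = (n.factorial : ℝ≥0∞) := by
  rw [← enorm_pow, ← Complex.ofReal_pow, Real.sq_sqrt (Nat.cast_nonneg _), Complex.ofReal_natCast,
    enorm_eq_nnnorm, Complex.nnnorm_natCast, ENNReal.coe_natCast]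

theorem lintegral_enorm_hat_sq_ofFn (f : Fock I) (n : ℕ) :
    (n.factorial : ℝ≥0∞)⁻¹ * ∫⁻ x : Fin n → ℝ, ‖hat f (List.ofFn x)‖ₑ ^ 2 ∂configMeasure I n =
      ‖f n‖ₑ ^ 2 := by
  have wave_meas := measurable_wave f n
  have lintegral_wave : ‖f n‖ₑ ^ 2 = ∫⁻ x, ‖wave f n x‖ₑ ^ 2 ∂configMeasure I n :=
    enorm_sq_eq_lintegral (f n : Lp ℂ 2 (configMeasure I n))
  have hat_sq : ∀ᵐ x : Fin n → ℝ ∂configMeasure I n,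
      ‖hat f (List.ofFn x)‖ₑ ^ 2 = n.factorial * ‖wave f n x‖ₑ ^ 2 := by
    filter_upwards [ae_hat_ofFn f n] with x hx
    rw [hx, enorm_mul, mul_pow, enorm_sqrt_factorial_sq]
  rw [lintegral_congr_ae hat_sq, lintegral_const_mul _ (by fun_prop), ← mul_assoc,
    inv_factorial_mul_factorial, one_mul, lintegral_wave]

theorem lintegral_poisson_pow_card_mul {μ : Measure ℝ} [SigmaFinite μ] (c : ℝ≥0∞)
    {F : Multiset ℝ → ℝ≥0∞} (hF : Measurable F) :
    ∫⁻ l : List ℝ, c ^ (l : Multiset ℝ).card * F l ∂poisson μ = ∑' n : ℕ, c ^ n *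
      ((n.factorial : ℝ≥0∞)⁻¹ * ∫⁻ x : Fin n → ℝ, F (List.ofFn x) ∂Measure.pi fun _ => μ) := by
  simp only [Multiset.coe_card]
  rw [lintegral_poisson_pi μ (by fun_prop)]
  refine tsum_congr fun n => ?_
  have ofFn_meas := measurable_ofFn (X := ℝ) n
  simp only [List.length_ofFn]
  rw [lintegral_const_mul _ (by fun_prop), mul_left_comm]

theorem lintegral_pow_card_mul_hat_sq (f : Fock I) (c : ℝ≥0∞) :
    ∫⁻ l : List ℝ, c ^ (l : Multiset ℝ).card * ‖hat f l‖ₑ ^ 2 ∂poisson (volume.restrict I) =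
      ∑' n : ℕ, c ^ n * ‖f n‖ₑ ^ 2 := by
  rw [lintegral_poisson_pow_card_mul c (F := fun m => ‖hat f m‖ₑ ^ 2) (by fun_prop)]
  simp only [lintegral_enorm_hat_sq_ofFn]

theorem lintegral_pow_card_mul_hat_sq_lt_top (f : expDomain I) (c : NNReal) :
    ∫⁻ l : List ℝ, (c : ℝ≥0∞) ^ (l : Multiset ℝ).card * ‖hat (f : Fock I) l‖ₑ ^ 2
      ∂poisson (volume.restrict I) < ∞ := by
  rw [lintegral_pow_card_mul_hat_sq]
  exact (summable_pow_mul_norm_sq_iff c _).1 (f.2 c)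

theorem lintegral_hat_sq_lt_top (f : Fock I) :
    ∫⁻ l : List ℝ, ‖hat f l‖ₑ ^ 2 ∂poisson (volume.restrict I) < ∞ := by
  have norm_sq_summable : Summable fun n => (1 : NNReal) ^ n * ‖f n‖ ^ 2 := by
    simpa only [NNReal.coe_one, one_pow, one_mul, ENNReal.toReal_ofNat, Real.rpow_ofNat] using
      (lp.memℓp f).summable (by norm_num)
  have lintegral_eq := lintegral_pow_card_mul_hat_sq f 1
  simp only [one_pow, one_mul] at lintegral_eq
  rw [lintegral_eq]
  simpa only [ENNReal.coe_one, one_pow, one_mul] using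
    (summable_pow_mul_norm_sq_iff 1 fun n => f n).1 norm_sq_summable

theorem inner_sector_eq_integral_hat (g h : Fock I) (n : ℕ) :
    ⟪g n, h n⟫_ℂ = ((n.factorial : ℝ≥0∞)⁻¹).toReal • ∫ x : Fin n → ℝ,
      conj (hat g (List.ofFn x)) * hat h (List.ofFn x) ∂configMeasure I n := by
  have inner_eq : ⟪g n, h n⟫_ℂ = ∫ x, conj (wave g n x) * wave h n x ∂configMeasure I n := by
    simp only [← RCLike.inner_apply']
    exact L2.inner_def _ _
  have sqrt_mul_sqrt : (Real.sqrt n.factorial : ℂ) * Real.sqrt n.factorial = n.factorial := by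
    rw [← Complex.ofReal_mul, Real.mul_self_sqrt (Nat.cast_nonneg _), Complex.ofReal_natCast]
  have conj_hat_mul_hat : ∀ᵐ x : Fin n → ℝ ∂configMeasure I n,
      conj (hat g (List.ofFn x)) * hat h (List.ofFn x) =
        n.factorial * (conj (wave g n x) * wave h n x) := by
    filter_upwards [ae_hat_ofFn g n, ae_hat_ofFn h n] with x hgx hhx
    rw [hgx, hhx, map_mul, Complex.conj_ofReal, mul_mul_mul_comm, sqrt_mul_sqrt]
  have factorial_ne_zero : (n.factorial : ℂ) ≠ 0 := Nat.cast_ne_zero.2 n.factorial_ne_zero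
  rw [inner_eq, integral_congr_ae conj_hat_mul_hat, integral_const_mul, Complex.real_smul,
    ENNReal.toReal_inv, ENNReal.toReal_natCast, Complex.ofReal_inv, Complex.ofReal_natCast,
    inv_mul_cancel_left₀ factorial_ne_zero]

theorem inner_eq_integral_hat (g h : Fock I) :
    ⟪g, h⟫_ℂ = ∫ l : List ℝ, conj (hat g l) * hat h l ∂poisson (volume.restrict I) := by
  have hint : Integrable (fun l : List ℝ => conj (hat g l) * hat h l)
      (poisson (volume.restrict I)) :=
    integrable_conj_mul_of_lintegral_sq_lt_top (by fun_prop) (by fun_prop)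
      (lintegral_hat_sq_lt_top g) (lintegral_hat_sq_lt_top h)
  refine (lp.hasSum_inner (𝕜 := ℂ) g h).unique ((hasSum_integral_measure hint).congr_fun
    fun n => ?_)
  rw [inner_sector_eq_integral_hat, integral_smul_measure, tupleMeasure_eq_map_pi,
    integral_map (measurable_ofFn n).aemeasurable
      (Measurable.aestronglyMeasurable (by fun_prop))]

theorem exists_sector_ae_eq {n : ℕ} {F : Multiset ℝ → ℂ} (hF : Measurable F)
    (hF2 : ∫⁻ x : Fin n → ℝ, ‖F (List.ofFn x)‖ₑ ^ 2 ∂configMeasure I n < ∞) :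
    ∃ v : sector I n, ∀ᵐ x ∂configMeasure I n,
      (v : Lp ℂ 2 (configMeasure I n)) x = F (List.ofFn x) := by
  have ofFn_meas := measurable_ofFn (X := ℝ) n
  have memLp := memLp_two_of_lintegral_sq_lt_top (by fun_prop) hF2
  refine ⟨⟨memLp.toLp, ?_⟩, memLp.coeFn_toLp⟩
  simp only [sector, Submodule.mem_iInf, LinearMap.mem_eqLocus, LinearMap.id_coe, id_eq]
  intro σ
  refine Lp.ext ((Lp.coeFn_compMeasurePreserving _ (measurePreserving_perm I σ)).trans ?_)
  filter_upwards [memLp.coeFn_toLp, (measurePreserving_perm I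
    σ).quasiMeasurePreserving.ae_eq_comp memLp.coeFn_toLp] with x hx hσx
  rw [hσx, hx, Function.comp_apply, Multiset.coe_eq_coe.2 (Equiv.Perm.ofFn_comp_perm σ x)]

theorem exists_expDomain_coeFn_eq {v : (n : ℕ) → sector I n}
    (hv : ∀ c : NNReal, ∑' n, (c : ℝ≥0∞) ^ n * ‖v n‖ₑ ^ 2 < ∞) :
    ∃ f : expDomain I, ∀ n, (f : Fock I) n = v n := by
  have summable (c : NNReal) := (summable_pow_mul_norm_sq_iff c v).2 (hv c)
  have memℓp : Memℓp v 2 := memℓp_gen (by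
    simpa only [NNReal.coe_one, one_pow, one_mul, ENNReal.toReal_ofNat, Real.rpow_ofNat] using
      summable 1)
  refine ⟨⟨⟨v, memℓp⟩, fun c => Summable.of_norm_bounded (summable ‖c‖₊) fun n => ?_⟩, fun n => rfl⟩
  rw [norm_mul, norm_pow, norm_pow, norm_norm, coe_nnnorm]

theorem exists_hat_ae_eq {H : Multiset ℝ → ℂ} (hH : Measurable H)
    (hH2 : ∀ c : NNReal, ∫⁻ l : List ℝ, (c : ℝ≥0∞) ^ (l : Multiset ℝ).card * ‖H l‖ₑ ^ 2
      ∂poisson (volume.restrict I) < ∞) :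
    ∃ h : expDomain I,
      ∀ᵐ l : List ℝ ∂poisson (volume.restrict I), hat (h : Fock I) l = H l := by
  set s : ℕ → ℂ := fun n => Real.sqrt n.factorial
  have s_ne_zero (n : ℕ) : s n ≠ 0 :=
    Complex.ofReal_ne_zero.2 (Real.sqrt_pos.2 (Nat.cast_pos.2 n.factorial_pos)).ne'
  have ofFn_meas (n : ℕ) := measurable_ofFn (X := ℝ) n
  have wave_sq (n : ℕ) : ∫⁻ x : Fin n → ℝ, ‖(s n)⁻¹ * H (List.ofFn x)‖ₑ ^ 2 ∂configMeasure I n =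
      (n.factorial : ℝ≥0∞)⁻¹ * ∫⁻ x : Fin n → ℝ, ‖H (List.ofFn x)‖ₑ ^ 2 ∂configMeasure I n := by
    simp only [enorm_mul, mul_pow, enorm_inv (s_ne_zero n), ← ENNReal.inv_pow, s,
      enorm_sqrt_factorial_sq]
    rw [lintegral_const_mul _ (by fun_prop)]
  have moments (c : NNReal) := hH2 c
  simp only [lintegral_poisson_pow_card_mul _ (F := fun m => ‖H m‖ₑ ^ 2) (by fun_prop),
    ← wave_sq] at moments
  have wave_sq_lt_top (n : ℕ) : ∫⁻ x : Fin n → ℝ, ‖(s n)⁻¹ * H (List.ofFn x)‖ₑ ^ 2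
      ∂configMeasure I n < ∞ := by
    simpa only [ENNReal.coe_one, one_pow, one_mul] using
      (ENNReal.le_tsum n).trans_lt (moments 1)
  choose v hv using fun n =>
    exists_sector_ae_eq (F := fun m => (s n)⁻¹ * H m) (by fun_prop) (wave_sq_lt_top n)
  have v_sq (n : ℕ) : ‖v n‖ₑ ^ 2 =
      ∫⁻ x : Fin n → ℝ, ‖(s n)⁻¹ * H (List.ofFn x)‖ₑ ^ 2 ∂configMeasure I n :=
    (enorm_sq_eq_lintegral (v n : Lp ℂ 2 (configMeasure I n))).trans
      (lintegral_congr_ae ((hv n).mono fun x hx => by simp only [hx]))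
  obtain ⟨h, h_eq⟩ := exists_expDomain_coeFn_eq (v := v) fun c => by
    simpa only [v_sq] using moments c
  refine ⟨h, (ae_poisson_iff _ (measurableSet_eq_fun (by fun_prop) (by fun_prop))).2 fun n => ?_⟩
  filter_upwards [ae_hat_ofFn (h : Fock I) n, hv n] with x hat_eq v_eq
  rw [hat_eq, wave, h_eq, v_eq, mul_inv_cancel_left₀ (s_ne_zero n)]

end Hat

/-! ### Kernels -/

section Kernels

/-- The kind of a point of the Dyson series: whether it creates and whether it annihilates a
particle. The kinds of `Q`, `L`, `R`, `T` are `(false, false)`, `(true, false)`, `(false, true)`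
and `(true, true)`. -/
abbrev Kind : Type := Bool × Bool

/-- The splitting of the kinds into creating and non-creating ones. -/
def splitCreate : Bool ⊕ Bool ≃ Kind where
  toFun := Sum.elim (fun b => (true, b)) fun b => (false, b)
  invFun k := bif k.1 then Sum.inl k.2 else Sum.inr k.2
  left_inv s := by cases s <;> rfl
  right_inv := by rintro ⟨_ | _, b⟩ <;> rfl

/-- The splitting of the kinds into non-annihilating and annihilating ones. -/
def splitAnnih : Bool ⊕ Bool ≃ Kind where
  toFun := Sum.elim (fun a => (a, false)) fun a => (a, true)
  invFun k := bif k.2 then Sum.inr k.1 else Sum.inl k.1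
  left_inv s := by cases s <;> rfl
  right_inv := by rintro ⟨a, _ | _⟩ <;> rfl

variable {X : Type*}

/-- The points that create a particle. -/
def createPts (ω : Multiset (X × Kind)) : Multiset X :=
  (ω.filter fun p => p.2.1 = true).map Prod.fst

/-- The points that annihilate a particle. -/
def annihPts (ω : Multiset (X × Kind)) : Multiset X :=
  (ω.filter fun p => p.2.2 = true).map Prod.fst

theorem createPts_labelledUnion (τ ρ : Multiset (X × Bool)) :
    createPts (labelledUnion splitCreate τ ρ) = τ.map Prod.fst := by
  simp [createPts, labelledUnion, splitCreate, Multiset.filter_map]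

theorem annihPts_labelledUnion (α τ : Multiset (X × Bool)) :
    annihPts (labelledUnion splitAnnih α τ) = τ.map Prod.fst := by
  simp [annihPts, labelledUnion, splitAnnih, Multiset.filter_map]

theorem pow_card_createPts {M : Type*} [CommMonoid M] (r : M) (ω : Multiset (X × Kind)) :
    r ^ (createPts ω).card = (ω.map fun p => bif p.2.1 then r else 1).prod := by
  induction ω using Multiset.induction with
  | empty => simp only [createPts, Multiset.filter_zero, Multiset.map_zero, Multiset.card_zero,
      pow_zero, Multiset.prod_zero]
  | cons p ω ih =>
    rw [Multiset.map_cons, Multiset.prod_cons, ← ih]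
    obtain ⟨x, _ | _, b⟩ := p <;> simp [createPts, pow_succ']

/-- The factor of `m = annihWeight m * createWeight m` which has no creating points, as needed for
the Cauchy–Schwarz inequality with respect to the other points. -/
def annihWeight (m : X × Kind → ℝ≥0∞) (p : X × Kind) : ℝ≥0∞ :=
  bif p.2.1 then 1 else bif p.2.2 then m p else m p ^ (1 / 2 : ℝ)

/-- The factor of `m = annihWeight m * createWeight m` which is one at the purely annihilating
points. -/
def createWeight (m : X × Kind → ℝ≥0∞) (p : X × Kind) : ℝ≥0∞ :=
  bif p.2.1 then m p else bif p.2.2 then 1 else m p ^ (1 / 2 : ℝ)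

theorem rpow_half_mul_rpow_half (a : ℝ≥0∞) : a ^ (1 / 2 : ℝ) * a ^ (1 / 2 : ℝ) = a := by
  rw [← ENNReal.rpow_add_of_nonneg _ _ one_half_pos.le one_half_pos.le, add_halves,
    ENNReal.rpow_one]

theorem annihWeight_mul_createWeight (m : X × Kind → ℝ≥0∞) (p : X × Kind) :
    annihWeight m p * createWeight m p = m p := by
  obtain ⟨x, _ | _, _ | _⟩ := p
  exacts [rpow_half_mul_rpow_half _, mul_one _, one_mul _, one_mul _]

variable [MeasurableSpace X] {μ : Measure X}

@[fun_prop]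
theorem measurable_createPts : Measurable (createPts (X := X)) :=
  (measurable_multiset_map measurable_fst).comp
    (measurable_multiset_filter (measurableSet_eq_fun (by fun_prop) measurable_const))

@[fun_prop]
theorem measurable_annihPts : Measurable (annihPts (X := X)) :=
  (measurable_multiset_map measurable_fst).comp
    (measurable_multiset_filter (measurableSet_eq_fun (by fun_prop) measurable_const))

/-- A bound for the coefficient functions of admissible tensors. -/
structure Majorant (μ : Measure X) (m : X × Kind → ℝ≥0∞) : Prop where
  measurable : Measurable m
  lintegral_Q_lt_top : ∫⁻ x, m (x, (false, false)) ∂μ < ∞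
  lintegral_L_sq_lt_top : ∫⁻ x, m (x, (true, false)) ^ 2 ∂μ < ∞
  lintegral_R_sq_lt_top : ∫⁻ x, m (x, (false, true)) ^ 2 ∂μ < ∞
  exists_T_le : ∃ t : NNReal, ∀ x, m (x, (true, true)) ≤ t

/-- Kernels with a multiplicative bound: the integral kernels, in the sense of Maassen, of the
operators considered here. -/
structure IsKernel (μ : Measure X) (κ : Multiset (X × Kind) → ℂ) : Prop where
  measurable : Measurable κ
  bound : ∃ (b : NNReal) (m : X × Kind → ℝ≥0∞), Majorant μ m ∧
    ∀ ω, ‖κ ω‖ₑ ≤ b * (ω.map m).prod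

/-- Square integrability with all exponential weights. -/
def ExpMoments (μ : Measure X) (φ : Multiset X → ℝ≥0∞) : Prop :=
  ∀ c : NNReal, ∫⁻ l : List X, (c : ℝ≥0∞) ^ (l : Multiset X).card * φ l ^ 2 ∂poisson μ < ∞

/-- The action of a kernel on a function of configurations: each point of the configuration was
created, with or without an annihilation (the label), and the other points are integrated out. -/
def kernelApply (μ : Measure X) (κ : Multiset (X × Kind) → ℂ) (φ : Multiset X → ℂ) :
    Multiset X → ℂ :=
  multisetLabelSum fun τ : Multiset (X × Bool) => ∫ ρ : List (X × Bool),
    κ (labelledUnion splitCreate τ ρ) * φ (annihPts (labelledUnion splitCreate τ ρ))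
      ∂poisson (labelled μ Bool)

/-- The action of the absolute value of a kernel on a function of configurations. -/
def absApply (μ : Measure X) (κ : Multiset (X × Kind) → ℂ) (φ : Multiset X → ℝ≥0∞) :
    Multiset X → ℝ≥0∞ :=
  multisetLabelSum fun τ : Multiset (X × Bool) => ∫⁻ ρ : List (X × Bool),
    ‖κ (labelledUnion splitCreate τ ρ)‖ₑ * φ (annihPts (labelledUnion splitCreate τ ρ))
      ∂poisson (labelled μ Bool)

theorem enorm_kernelApply_le (κ : Multiset (X × Kind) → ℂ) (φ : Multiset X → ℂ) (l : List X) :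
    ‖kernelApply μ κ φ l‖ₑ ≤ absApply μ κ (fun m => ‖φ m‖ₑ) l := by
  refine (enorm_labelSum_le _ l).trans (labelSum_mono (fun τ => ?_) l)
  refine (enorm_integral_le_lintegral_enorm _).trans (lintegral_mono fun ρ => ?_)
  rw [enorm_mul]

theorem measurable_absApply [SFinite μ] {κ : Multiset (X × Kind) → ℂ} (hκ : Measurable κ)
    {φ : Multiset X → ℝ≥0∞} (hφ : Measurable φ) : Measurable (absApply μ κ φ) :=
  measurable_multisetLabelSum (measurable_multiset_iff.2 (by fun_prop))

theorem measurable_kernelApply [SFinite μ] {κ : Multiset (X × Kind) → ℂ} (hκ : Measurable κ)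
    {φ : Multiset X → ℂ} (hφ : Measurable φ) : Measurable (kernelApply μ κ φ) := by
  refine measurable_multisetLabelSum (measurable_multiset_iff.2 ?_)
  have integrand_meas : Measurable fun q : List (X × Bool) × List (X × Bool) =>
      κ (labelledUnion splitCreate q.1 q.2) * φ (annihPts (labelledUnion splitCreate q.1 q.2)) := by
    fun_prop
  exact integrand_meas.stronglyMeasurable.integral_prod_right'.measurable

/-! ### Kernels preserve exponential moments -/

theorem sq_lintegral_mul_le {α : Type*} [MeasurableSpace α] {ν : Measure α} {f g : α → ℝ≥0∞}
    (hf : Measurable f) (hg : Measurable g) :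
    (∫⁻ x, f x * g x ∂ν) ^ 2 ≤ (∫⁻ x, f x ^ 2 ∂ν) * ∫⁻ x, g x ^ 2 ∂ν := by
  have hölder := ENNReal.lintegral_mul_le_Lp_mul_Lq ν Real.HolderConjugate.two_two hf.aemeasurable
    hg.aemeasurable
  simp only [Pi.mul_apply, ENNReal.rpow_ofNat] at hölder
  calc (∫⁻ x, f x * g x ∂ν) ^ 2
      ≤ ((∫⁻ x, f x ^ 2 ∂ν) ^ (1 / 2 : ℝ) * (∫⁻ x, g x ^ 2 ∂ν) ^ (1 / 2 : ℝ)) ^ 2 := by gcongr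
    _ = _ := by
      rw [mul_pow, ← ENNReal.rpow_natCast, ← ENNReal.rpow_natCast, ← ENNReal.rpow_mul,
        ← ENNReal.rpow_mul]
      norm_num

section Labels

variable {C : Type*} [Fintype C] [MeasurableSpace C]

theorem sq_labelSum_le {F : List (X × C) → ℝ≥0∞} (hF : Measurable F) (l : List X) :
    labelSum F l ^ 2 ≤ (Fintype.card C : ℝ≥0∞) ^ l.length * labelSum (fun t => F t ^ 2) l := by
  have cauchy_schwarz :=
    sq_lintegral_mul_le (ν := labelKernel X C l) (f := fun _ => 1) measurable_const hF
  simp only [one_mul, one_pow] at cauchy_schwarz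
  rwa [lintegral_labelKernel hF, lintegral_labelKernel measurable_const,
    lintegral_labelKernel (hF.pow_const 2), labelSum_one] at cauchy_schwarz

theorem lintegral_pow_card_mul_sq_labelSum_le [MeasurableSingletonClass C] [SFinite μ]
    {F : List (X × C) → ℝ≥0∞} (hF : Measurable F) (c : ℝ≥0∞) :
    ∫⁻ l : List X, c ^ (l : Multiset X).card * labelSum F l ^ 2 ∂poisson μ ≤
      ∫⁻ t, (Fintype.card C * c) ^ (t : Multiset (X × C)).card * F t ^ 2
        ∂poisson (labelled μ C) := by
  rw [lintegral_poisson_labelSum μ (by fun_prop)]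
  refine lintegral_mono fun l => ?_
  have weight := mul_labelSum (fun t => F t ^ 2) (fun l => (Fintype.card C * c) ^ l.length) l
  simp only [List.length_map] at weight
  simp only [Multiset.coe_card]
  rw [← weight, mul_comm (Fintype.card C : ℝ≥0∞), mul_pow, mul_assoc]
  gcongr
  exact sq_labelSum_le hF l

theorem lintegral_poisson_labelled_map_fst [MeasurableSingletonClass C] [SFinite μ]
    {φ : Multiset X → ℝ≥0∞} (hφ : Measurable φ) :
    ∫⁻ τ : List (X × C), φ ((τ : Multiset (X × C)).map Prod.fst) ∂poisson (labelled μ C) =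
      ∫⁻ l : List X, Fintype.card C ^ (l : Multiset X).card * φ l ∂poisson μ := by
  rw [lintegral_poisson_labelSum μ (by fun_prop)]
  refine lintegral_congr fun l => ?_
  have weight := mul_labelSum (C := C) (fun _ => 1) (fun l : List X => φ l) l
  simp only [mul_one, labelSum_one] at weight
  simpa only [Multiset.map_coe, Multiset.coe_card, mul_comm] using weight.symm

end Labels

theorem lintegral_labelled_bool [SFinite μ] {q : X × Bool → ℝ≥0∞} (hq : Measurable q) :
    ∫⁻ p, q p ∂labelled μ Bool = ∫⁻ x, q (x, true) ∂μ + ∫⁻ x, q (x, false) ∂μ := by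
  simp only [lintegral_labelled _ hq, Fintype.sum_bool]
  exact lintegral_add_left (by fun_prop) _

@[fun_prop]
theorem measurable_annihWeight {m : X × Kind → ℝ≥0∞} (hm : Measurable m) :
    Measurable (annihWeight m) := by
  refine measurable_from_prod_countable_left ?_
  rintro ⟨_ | _, _ | _⟩ <;> simp only [annihWeight, cond_false, cond_true] <;> fun_prop

@[fun_prop]
theorem measurable_createWeight {m : X × Kind → ℝ≥0∞} (hm : Measurable m) :
    Measurable (createWeight m) := by
  refine measurable_from_prod_countable_left ?_
  rintro ⟨_ | _, _ | _⟩ <;> simp only [createWeight, cond_false, cond_true] <;> fun_prop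

theorem lintegral_prod_annihWeight_sq_lt_top [SFinite μ] {m : X × Kind → ℝ≥0∞}
    (hm : Majorant μ m) :
    ∫⁻ ρ : List (X × Bool), ((ρ : Multiset (X × Bool)).map fun p =>
      annihWeight m (p.1, (false, p.2)) ^ 2).prod ∂poisson (labelled μ Bool) < ∞ := by
  have m_meas := hm.measurable
  refine lintegral_poisson_prod_lt_top _ (by fun_prop) ?_
  rw [lintegral_labelled_bool (by fun_prop)]
  refine (ENNReal.add_lt_top.2 ⟨hm.lintegral_R_sq_lt_top, ?_⟩).ne
  simpa only [annihWeight, cond_false, sq, rpow_half_mul_rpow_half] using hm.lintegral_Q_lt_top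

theorem sq_lintegral_kernel_mul_le {κ : Multiset (X × Kind) → ℂ} {b : ℝ≥0∞}
    {m : X × Kind → ℝ≥0∞} (hm : Measurable m) (hκ : ∀ ω, ‖κ ω‖ₑ ≤ b * (ω.map m).prod)
    {φ : Multiset X → ℝ≥0∞} (hφ : Measurable φ) (τ : List (X × Bool)) :
    (∫⁻ ρ : List (X × Bool), ‖κ (labelledUnion splitCreate τ ρ)‖ₑ *
      φ (annihPts (labelledUnion splitCreate τ ρ)) ∂poisson (labelled μ Bool)) ^ 2 ≤
    b ^ 2 * (∫⁻ ρ : List (X × Bool), ((ρ : Multiset (X × Bool)).map fun p =>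
      annihWeight m (p.1, (false, p.2)) ^ 2).prod ∂poisson (labelled μ Bool)) *
    ∫⁻ ρ : List (X × Bool), ((labelledUnion splitCreate τ ρ).map fun p =>
      createWeight m p ^ 2).prod * φ (annihPts (labelledUnion splitCreate τ ρ)) ^ 2
        ∂poisson (labelled μ Bool) := by
  have κ_le (ω : Multiset (X × Kind)) : ‖κ ω‖ₑ * φ (annihPts ω) ≤
      b * (ω.map (annihWeight m)).prod * ((ω.map (createWeight m)).prod * φ (annihPts ω)) := by
    rw [← mul_assoc, mul_assoc b, ← Multiset.prod_map_mul]
    simp only [annihWeight_mul_createWeight]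
    gcongr
    exact hκ ω
  have annihWeight_union (ρ : List (X × Bool)) :
      ((labelledUnion splitCreate τ ρ).map (annihWeight m)).prod ^ 2 =
        ((ρ : Multiset (X × Bool)).map fun p => annihWeight m (p.1, (false, p.2)) ^ 2).prod := by
    have creating (p : X × Bool) : annihWeight m (p.1, splitCreate (Sum.inl p.2)) = 1 := rfl
    simp only [prod_map_labelledUnion, creating, Multiset.map_const', Multiset.prod_replicate,
      one_pow, one_mul, ← Multiset.prod_map_pow]
    rfl
  calc _ ≤ (∫⁻ ρ : List (X × Bool), b * ((labelledUnion splitCreate τ ρ).map (annihWeight m)).prod *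
        (((labelledUnion splitCreate τ ρ).map (createWeight m)).prod *
          φ (annihPts (labelledUnion splitCreate τ ρ))) ∂poisson (labelled μ Bool)) ^ 2 := by
        gcongr ?_ ^ 2
        exact lintegral_mono fun ρ => κ_le _
    _ ≤ _ := sq_lintegral_mul_le (by fun_prop) (by fun_prop)
    _ = _ := by
      simp only [mul_pow, annihWeight_union, Multiset.prod_map_pow]
      rw [lintegral_const_mul _ (by fun_prop)]

variable [SFinite μ]

theorem lintegral_pow_card_mul_lintegral_labelledUnion {G : Multiset (X × Kind) → ℝ≥0∞}
    (hG : Measurable G) (r : ℝ≥0∞) :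
    ∫⁻ τ : List (X × Bool), r ^ (τ : Multiset (X × Bool)).card *
      ∫⁻ ρ : List (X × Bool), G (labelledUnion splitCreate τ ρ)
        ∂poisson (labelled μ Bool) ∂poisson (labelled μ Bool) =
      ∫⁻ ω : List (X × Kind), r ^ (createPts (ω : Multiset (X × Kind))).card * G ω
        ∂poisson (labelled μ Kind) := by
  rw [lintegral_poisson_labelled μ splitCreate
    (F := fun ω => r ^ (createPts ω).card * G ω) (by fun_prop)]
  refine lintegral_congr fun τ => ?_
  simp only [createPts_labelledUnion, Multiset.card_map]
  rw [lintegral_const_mul _ (by fun_prop)]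

theorem lintegral_prod_map_mul_annihPts_lt_top {w : X × Kind → ℝ≥0∞} (hw : Measurable w)
    (hQ : ∫⁻ x, w (x, (false, false)) ∂μ < ∞) (hL : ∫⁻ x, w (x, (true, false)) ∂μ < ∞)
    {d : NNReal} (hd : ∀ x a, w (x, (a, true)) ≤ d) {φ : Multiset X → ℝ≥0∞} (hφ : Measurable φ)
    (hφ2 : ExpMoments μ φ) :
    ∫⁻ ω : List (X × Kind), ((ω : Multiset (X × Kind)).map w).prod * φ (annihPts ω) ^ 2
      ∂poisson (labelled μ Kind) < ∞ := by
  have union_le (α τ : List (X × Bool)) : ((labelledUnion splitAnnih α τ).map w).prod *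
      φ (annihPts (labelledUnion splitAnnih α τ)) ^ 2 ≤
      ((α : Multiset (X × Bool)).map fun p => w (p.1, (p.2, false))).prod *
        ((d : ℝ≥0∞) ^ ((τ : Multiset (X × Bool)).map Prod.fst).card *
          φ ((τ : Multiset (X × Bool)).map Prod.fst) ^ 2) := by
    rw [prod_map_labelledUnion, annihPts_labelledUnion, mul_assoc, Multiset.card_map]
    refine mul_le_mul' le_rfl (mul_le_mul' ?_ le_rfl)
    rw [← Multiset.prod_replicate, ← Multiset.map_const']
    exact Multiset.prod_map_le_prod_map _ _ fun p _ => hd _ _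
  have nonannihilating : ∫⁻ α : List (X × Bool), ((α : Multiset (X × Bool)).map fun p =>
      w (p.1, (p.2, false))).prod ∂poisson (labelled μ Bool) < ∞ := by
    refine lintegral_poisson_prod_lt_top _ (by fun_prop) ?_
    rw [lintegral_labelled_bool (by fun_prop)]
    exact (ENNReal.add_lt_top.2 ⟨hL, hQ⟩).ne
  rw [lintegral_poisson_labelled μ splitAnnih
    (F := fun ω => (ω.map w).prod * φ (annihPts ω) ^ 2) (by fun_prop)]
  refine (lintegral_mono fun α => lintegral_mono fun τ => union_le α τ).trans_lt ?_
  simp_rw [lintegral_const_mul _ (show Measurable fun τ : List (X × Bool) =>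
    (d : ℝ≥0∞) ^ ((τ : Multiset (X × Bool)).map Prod.fst).card *
      φ ((τ : Multiset (X × Bool)).map Prod.fst) ^ 2 by fun_prop)]
  rw [lintegral_mul_const _ (by fun_prop),
    lintegral_poisson_labelled_map_fst (φ := fun m => (d : ℝ≥0∞) ^ m.card * φ m ^ 2) (by fun_prop)]
  refine ENNReal.mul_lt_top nonannihilating ?_
  simpa only [Fintype.card_bool, Nat.cast_ofNat, ENNReal.coe_mul, ENNReal.coe_ofNat, mul_pow,
    mul_assoc] using hφ2 (2 * d)

theorem lintegral_createWeight_lt_top {m : X × Kind → ℝ≥0∞} (hm : Majorant μ m)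
    {φ : Multiset X → ℝ≥0∞} (hφ : Measurable φ) (hφ2 : ExpMoments μ φ) (r : NNReal) :
    ∫⁻ ω : List (X × Kind), (r : ℝ≥0∞) ^ (createPts (ω : Multiset (X × Kind))).card *
      (((ω : Multiset (X × Kind)).map fun p => createWeight m p ^ 2).prod * φ (annihPts ω) ^ 2)
        ∂poisson (labelled μ Kind) < ∞ := by
  have m_meas := hm.measurable
  obtain ⟨t, m_le⟩ := hm.exists_T_le
  set w : X × Kind → ℝ≥0∞ := fun p => (bif p.2.1 then (r : ℝ≥0∞) else 1) * createWeight m p ^ 2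
  have w_meas : Measurable w := by
    refine measurable_from_prod_countable_left fun k => ?_
    exact (by fun_prop : Measurable fun x => createWeight m (x, k) ^ 2).const_mul
      (bif k.1 then (r : ℝ≥0∞) else 1)
  simp only [pow_card_createPts, ← mul_assoc, ← Multiset.prod_map_mul]
  refine lintegral_prod_map_mul_annihPts_lt_top (d := 1 + r * t ^ 2) w_meas ?_ ?_ ?_ hφ hφ2
  · simpa only [w, createWeight, cond_false, one_mul, sq, rpow_half_mul_rpow_half] using
      hm.lintegral_Q_lt_top
  · simp only [w, createWeight, cond_true]
    rw [lintegral_const_mul _ (by fun_prop)]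
    exact ENNReal.mul_lt_top ENNReal.coe_lt_top hm.lintegral_L_sq_lt_top
  · rintro x (_ | _)
    · simp [w, createWeight]
    · simp only [w, createWeight, cond_true, ENNReal.coe_add, ENNReal.coe_mul, ENNReal.coe_pow]
      refine le_add_left ?_
      gcongr
      exact m_le x

theorem ExpMoments.absApply {κ : Multiset (X × Kind) → ℂ} (hκ : IsKernel μ κ)
    {φ : Multiset X → ℝ≥0∞} (hφ : Measurable φ) (hφ2 : ExpMoments μ φ) :
    ExpMoments μ (absApply μ κ φ) := by
  intro c
  have κ_meas := hκ.measurable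
  obtain ⟨b, m, hm, κ_le⟩ := hκ.bound
  have m_meas := hm.measurable
  refine (lintegral_pow_card_mul_sq_labelSum_le (by fun_prop) (c : ℝ≥0∞)).trans_lt ?_
  refine (lintegral_mono fun τ =>
    mul_le_mul_right (sq_lintegral_kernel_mul_le m_meas κ_le hφ τ) _).trans_lt ?_
  simp_rw [mul_left_comm _ ((b : ℝ≥0∞) ^ 2 * _)]
  rw [lintegral_const_mul _ (by fun_prop), lintegral_pow_card_mul_lintegral_labelledUnion
    (G := fun ω => (ω.map fun p => createWeight m p ^ 2).prod * φ (annihPts ω) ^ 2) (by fun_prop)]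
  refine ENNReal.mul_lt_top (ENNReal.mul_lt_top (by simp) (lintegral_prod_annihWeight_sq_lt_top hm))
    ?_
  simpa only [Fintype.card_bool, Nat.cast_ofNat, ENNReal.coe_mul, ENNReal.coe_ofNat] using
    lintegral_createWeight_lt_top hm hφ hφ2 (2 * c)

end Kernels

/-! ### The form and the operator of a kernel -/

section KernelIntegrals

variable {X : Type*} [MeasurableSpace X] {μ : Measure X} [SFinite μ] {κ : Multiset (X × Kind) → ℂ}

theorem lintegral_kernel_eq_lintegral_absApply (hκ : Measurable κ) {G φ : Multiset X → ℝ≥0∞}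
    (hG : Measurable G) (hφ : Measurable φ) :
    ∫⁻ ω : List (X × Kind), ‖κ ω‖ₑ * (G (createPts ω) * φ (annihPts ω)) ∂poisson (labelled μ Kind) =
      ∫⁻ l : List X, G l * absApply μ κ φ l ∂poisson μ := by
  rw [lintegral_poisson_labelled μ splitCreate
      (F := fun ω => ‖κ ω‖ₑ * (G (createPts ω) * φ (annihPts ω))) (by fun_prop),
    lintegral_poisson_labelSum μ (by fun_prop)]
  refine lintegral_congr fun l => ?_
  rw [absApply, multisetLabelSum_coe, mul_labelSum _ fun l : List X => G l]
  refine labelSum_congr fun τ _ => ?_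
  rw [← lintegral_const_mul _ (by fun_prop)]
  simp only [createPts_labelledUnion, Multiset.map_coe, mul_left_comm]

theorem lintegral_kernel_lt_top (hκ : IsKernel μ κ) {G φ : Multiset X → ℝ≥0∞} (hG : Measurable G)
    (hφ : Measurable φ) (hG2 : ∫⁻ l : List X, G l ^ 2 ∂poisson μ < ∞) (hφ2 : ExpMoments μ φ) :
    ∫⁻ ω : List (X × Kind), ‖κ ω‖ₑ * (G (createPts ω) * φ (annihPts ω))
      ∂poisson (labelled μ Kind) < ∞ := by
  have absApply_meas := measurable_absApply (μ := μ) hκ.measurable hφ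
  have absApply_sq_lt_top := hφ2.absApply hκ hφ 1
  simp only [ENNReal.coe_one, one_pow, one_mul] at absApply_sq_lt_top
  rw [lintegral_kernel_eq_lintegral_absApply hκ.measurable hG hφ]
  have sq_lt_top :=
    (sq_lintegral_mul_le (f := fun l : List X => G l) (by fun_prop) (by fun_prop)).trans_lt
      (ENNReal.mul_lt_top hG2 absApply_sq_lt_top)
  exact (ENNReal.pow_lt_top_iff.1 sq_lt_top).resolve_right two_ne_zero

theorem integrable_kernel (hκ : IsKernel μ κ) {G φ : Multiset X → ℂ} (hG : Measurable G)
    (hφ : Measurable φ) (hG2 : ∫⁻ l : List X, ‖G l‖ₑ ^ 2 ∂poisson μ < ∞)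
    (hφ2 : ExpMoments μ fun m => ‖φ m‖ₑ) :
    Integrable (fun ω : List (X × Kind) => κ ω * (conj (G (createPts ω)) * φ (annihPts ω)))
      (poisson (labelled μ Kind)) := by
  have κ_meas := hκ.measurable
  refine ⟨Measurable.aestronglyMeasurable (by fun_prop), ?_⟩
  rw [hasFiniteIntegral_iff_enorm]
  simpa only [enorm_mul, RCLike.enorm_conj] using
    lintegral_kernel_lt_top hκ hG.enorm hφ.enorm hG2 hφ2

theorem integral_kernel_eq_integral_kernelApply (hκ : IsKernel μ κ) {G φ : Multiset X → ℂ}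
    (hG : Measurable G) (hφ : Measurable φ) (hG2 : ∫⁻ l : List X, ‖G l‖ₑ ^ 2 ∂poisson μ < ∞)
    (hφ2 : ExpMoments μ fun m => ‖φ m‖ₑ) :
    ∫ ω : List (X × Kind), κ ω * (conj (G (createPts ω)) * φ (annihPts ω))
        ∂poisson (labelled μ Kind) =
      ∫ l : List X, conj (G l) * kernelApply μ κ φ l ∂poisson μ := by
  have κ_meas := hκ.measurable
  have integrand_meas : Measurable fun ω => κ ω * (conj (G (createPts ω)) * φ (annihPts ω)) := by
    fun_prop
  have union_meas : Measurable fun q : List (X × Bool) × List (X × Bool) =>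
      κ (labelledUnion splitCreate q.1 q.2) *
        (conj (G (createPts (labelledUnion splitCreate q.1 q.2))) *
          φ (annihPts (labelledUnion splitCreate q.1 q.2))) := by fun_prop
  have union_integrable := (integrable_poisson_labelled_iff μ splitCreate integrand_meas).1
    (integrable_kernel hκ hG hφ hG2 hφ2)
  rw [integral_poisson_labelled μ splitCreate integrand_meas, integral_prod _ union_integrable,
    integral_poisson_labelSum μ union_meas.stronglyMeasurable.integral_prod_right'.measurable
      union_integrable.integral_prod_left]
  refine integral_congr_ae (.of_forall fun l => ?_)
  simp only [kernelApply, multisetLabelSum_coe, ← labelSum_const_mul]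
  refine labelSum_congr fun τ τ_eq => ?_
  rw [← integral_const_mul]
  refine integral_congr_ae (.of_forall fun ρ => ?_)
  simp only [createPts_labelledUnion, Multiset.map_coe, τ_eq]
  ring

theorem ae_annihPts {p : Multiset X → Prop} (hp : MeasurableSet {m | p m})
    (h : ∀ᵐ l : List X ∂poisson μ, p l) :
    ∀ᵐ ω : List (X × Kind) ∂poisson (labelled μ Kind), p (annihPts ω) := by
  set ind : Multiset X → ℝ≥0∞ := {m | p m}ᶜ.indicator fun _ => 1
  have ind_meas : Measurable ind := measurable_const.indicator hp.compl
  have lintegral_ind : ∫⁻ ω : List (X × Kind), ind (annihPts ω) ∂poisson (labelled μ Kind) = 0 := by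
    rw [lintegral_poisson_labelled μ splitAnnih (F := fun ω => ind (annihPts ω)) (by fun_prop)]
    simp only [annihPts_labelledUnion]
    rw [lintegral_poisson_labelled_map_fst ind_meas,
      lintegral_eq_zero_of_ae_eq_zero (h.mono fun l hl => ?_), lintegral_zero]
    simp [ind, hl]
  rw [lintegral_eq_zero_iff (by fun_prop)] at lintegral_ind
  filter_upwards [lintegral_ind] with ω hω
  by_contra not_p
  simp [ind, not_p] at hω

theorem ExpMoments.kernelApply (hκ : IsKernel μ κ) {φ : Multiset X → ℂ} (hφ : Measurable φ)
    (hφ2 : ExpMoments μ fun m => ‖φ m‖ₑ) :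
    ExpMoments μ fun m => ‖kernelApply μ κ φ m‖ₑ := by
  intro c
  refine lt_of_le_of_lt (lintegral_mono fun l => ?_) (hφ2.absApply hκ hφ.enorm c)
  gcongr
  exact enorm_kernelApply_le κ φ l

end KernelIntegrals

section KernelOperator

variable {I : Set ℝ} {κ : Multiset (ℝ × Kind) → ℂ}

theorem expMoments_hat (f : expDomain I) :
    ExpMoments (volume.restrict I) fun m => ‖hat (f : Fock I) m‖ₑ :=
  lintegral_pow_card_mul_hat_sq_lt_top f

/-- The sesquilinear form of a kernel. -/
def kernelForm (I : Set ℝ) (κ : Multiset (ℝ × Kind) → ℂ) (g f : Fock I) : ℂ :=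
  ∫ ω : List (ℝ × Kind), κ ω * (conj (hat g (createPts ω)) * hat f (annihPts ω))
    ∂poisson (labelled (volume.restrict I) Kind)

theorem integrable_kernelForm (hκ : IsKernel (volume.restrict I) κ) (g : Fock I)
    (f : expDomain I) :
    Integrable (fun ω : List (ℝ × Kind) =>
      κ ω * (conj (hat g (createPts ω)) * hat (f : Fock I) (annihPts ω)))
      (poisson (labelled (volume.restrict I) Kind)) :=
  integrable_kernel hκ (measurable_hat g) (measurable_hat _) (lintegral_hat_sq_lt_top g)
    (expMoments_hat f)

theorem exists_inner_eq_kernelForm (hκ : IsKernel (volume.restrict I) κ) (f : expDomain I) :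
    ∃ h : expDomain I, (∀ᵐ l : List ℝ ∂poisson (volume.restrict I),
        hat (h : Fock I) l = kernelApply (volume.restrict I) κ (hat (f : Fock I)) l) ∧
      ∀ g : Fock I, ⟪g, (h : Fock I)⟫_ℂ = kernelForm I κ g f := by
  have hat_f_meas := measurable_hat (f : Fock I)
  obtain ⟨h, hat_h⟩ := exists_hat_ae_eq (measurable_kernelApply hκ.measurable hat_f_meas)
    ((expMoments_hat f).kernelApply hκ hat_f_meas)
  refine ⟨h, hat_h, fun g => ?_⟩
  rw [inner_eq_integral_hat, kernelForm, integral_kernel_eq_integral_kernelApply hκ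
    (measurable_hat g) hat_f_meas (lintegral_hat_sq_lt_top g) (expMoments_hat f)]
  exact integral_congr_ae (hat_h.mono fun l hl => by simp only [hl])

theorem ae_hat_of_inner_eq_kernelForm (hκ : IsKernel (volume.restrict I) κ) {f h : expDomain I}
    (hf : ∀ g : Fock I, ⟪g, (h : Fock I)⟫_ℂ = kernelForm I κ g f) :
    ∀ᵐ l : List ℝ ∂poisson (volume.restrict I),
      hat (h : Fock I) l = kernelApply (volume.restrict I) κ (hat (f : Fock I)) l := by
  obtain ⟨h', hat_h', inner_h'⟩ := exists_inner_eq_kernelForm hκ f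
  rwa [show h = h' from Subtype.ext (ext_inner_left ℂ fun g => by rw [hf, inner_h'])]

theorem ae_hat_add_smul (f₁ f₂ : Fock I) (a b : ℂ) : ∀ᵐ l : List ℝ ∂poisson (volume.restrict I),
    hat (a • f₁ + b • f₂) l = a * hat f₁ l + b * hat f₂ l := by
  refine (ae_poisson_iff _ (measurableSet_eq_fun (by fun_prop) (by fun_prop))).2 fun n => ?_
  filter_upwards [ae_hat_ofFn f₁ n, ae_hat_ofFn f₂ n, ae_hat_ofFn (a • f₁ + b • f₂) n,
    Lp.coeFn_add (a • (f₁ n : Lp ℂ 2 (configMeasure I n)))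
      (b • (f₂ n : Lp ℂ 2 (configMeasure I n))),
    Lp.coeFn_smul a (f₁ n : Lp ℂ 2 (configMeasure I n)),
    Lp.coeFn_smul b (f₂ n : Lp ℂ 2 (configMeasure I n))]
    with x hat_f₁ hat_f₂ hat_sum add_apply smul_f₁ smul_f₂
  have wave_sum : wave (a • f₁ + b • f₂) n x = a * wave f₁ n x + b * wave f₂ n x := by
    simp only [wave]
    refine add_apply.trans ?_
    rw [Pi.add_apply, smul_f₁, smul_f₂]
    rfl
  rw [hat_f₁, hat_f₂, hat_sum, wave_sum]
  ring

theorem kernelForm_add_smul (hκ : IsKernel (volume.restrict I) κ) (g : Fock I)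
    (f₁ f₂ : expDomain I) (a b : ℂ) :
    kernelForm I κ g (a • (f₁ : Fock I) + b • (f₂ : Fock I)) =
      a * kernelForm I κ g f₁ + b * kernelForm I κ g f₂ := by
  simp only [kernelForm]
  rw [← integral_const_mul, ← integral_const_mul, ← integral_add
    ((integrable_kernelForm hκ g f₁).const_mul a) ((integrable_kernelForm hκ g f₂).const_mul b)]
  refine integral_congr_ae ?_
  have hat_annihPts := ae_annihPts (p := fun m => hat (a • (f₁ : Fock I) + b • (f₂ : Fock I)) m =
      a * hat (f₁ : Fock I) m + b * hat (f₂ : Fock I) m)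
    (measurableSet_eq_fun (by fun_prop) (by fun_prop)) (ae_hat_add_smul (f₁ : Fock I) f₂ a b)
  filter_upwards [hat_annihPts] with ω hω
  rw [hω]
  ring

theorem exists_linearMap_inner_eq_kernelForm (hκ : IsKernel (volume.restrict I) κ) :
    ∃ O : expDomain I →ₗ[ℂ] expDomain I, ∀ (g : Fock I) (f : expDomain I),
      ⟪g, (O f : Fock I)⟫_ℂ = kernelForm I κ g f := by
  choose O _ inner_O using fun f => exists_inner_eq_kernelForm hκ f
  have O_linear (f₁ f₂ : expDomain I) (a b : ℂ) : O (a • f₁ + b • f₂) = a • O f₁ + b • O f₂ := by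
    refine Subtype.ext (ext_inner_left ℂ fun g => ?_)
    push_cast
    rw [inner_O, inner_add_right, inner_smul_right, inner_smul_right, inner_O, inner_O]
    exact kernelForm_add_smul hκ g f₁ f₂ a b
  exact ⟨{ toFun := O
           map_add' := fun f₁ f₂ => by simpa only [one_smul] using O_linear f₁ f₂ 1 1
           map_smul' := fun a f => by
            simpa only [zero_smul, add_zero, RingHom.id_apply] using O_linear f 0 a 0 },
    fun g f => inner_O f g⟩

end KernelOperator

/-! ### The Dyson series of regular tensors -/

section PointOrder

/-- The lexicographic position of a labelled point: first the point, then the label. -/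
def pointKey (p : ℝ × Kind) : ℝ ×ₗ Bool ×ₗ Bool := toLex (p.1, toLex p.2)

/-- A total order of the labelled points which refines the order of the points, so that every
configuration has a canonical enumeration. -/
def pointLe (p q : ℝ × Kind) : Prop := pointKey p ≤ pointKey q

theorem pointLe_iff {p q : ℝ × Kind} :
    pointLe p q ↔ p.1 < q.1 ∨ p.1 = q.1 ∧ toLex p.2 ≤ toLex q.2 :=
  Prod.Lex.toLex_le_toLex

theorem pointKey_injective : Function.Injective pointKey := fun p q hpq => by
  obtain ⟨point_eq, kind_eq⟩ := Prod.mk.inj (toLex.injective hpq)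
  exact Prod.ext point_eq (toLex.injective kind_eq)

instance instDecidableRelPointLe : DecidableRel pointLe := fun _ _ => Classical.propDecidable _

instance instIsTransPointLe : IsTrans (ℝ × Kind) pointLe := ⟨fun _ _ _ => le_trans⟩

instance instAntisymmPointLe : Std.Antisymm pointLe :=
  ⟨fun _ _ hpq hqp => pointKey_injective (le_antisymm hpq hqp)⟩

instance instTotalPointLe : Std.Total pointLe := ⟨fun _ _ => le_total _ _⟩

theorem measurableSet_pointLe : MeasurableSet {p : (ℝ × Kind) × (ℝ × Kind) | pointLe p.1 p.2} := by
  have point_lt : MeasurableSet {p : (ℝ × Kind) × (ℝ × Kind) | p.1.1 < p.2.1} :=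
    measurableSet_lt (by fun_prop) (by fun_prop)
  have point_eq : MeasurableSet {p : (ℝ × Kind) × (ℝ × Kind) | p.1.1 = p.2.1} :=
    measurableSet_eq_fun (by fun_prop) (by fun_prop)
  have kinds_meas : Measurable fun p : (ℝ × Kind) × (ℝ × Kind) => (p.1.2, p.2.2) := by fun_prop
  have kind_le := kinds_meas
    (Set.toFinite {k : Kind × Kind | toLex k.1 ≤ toLex k.2}).measurableSet
  simp only [pointLe_iff]
  exact point_lt.union (point_eq.inter kind_le)

theorem sort_pointLe_of_pairwise {t : List (ℝ × Kind)} (ht : t.Pairwise fun p q => p.1 < q.1) :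
    (t : Multiset (ℝ × Kind)).sort pointLe = t :=
  (Multiset.coe_eq_coe.1 (Multiset.sort_eq (t : Multiset (ℝ × Kind)) pointLe)).eq_of_pairwise'
    (r := pointLe) (Multiset.pairwise_sort _ _) (ht.imp fun hpq => pointLe_iff.2 (Or.inl hpq))

end PointOrder

section MatrixSize

variable {ι : Type*} [Fintype ι]

/-- The sum of the absolute values of the entries, a submultiplicative norm with values in
`ℝ≥0∞`. -/
def matSize (M : Matrix ι ι ℂ) : ℝ≥0∞ := ∑ i, ∑ j, ‖M i j‖ₑ

theorem matSize_mul_le (M N : Matrix ι ι ℂ) : matSize (M * N) ≤ matSize M * matSize N := by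
  have row_le (j : ι) : ∑ k, ‖N j k‖ₑ ≤ matSize N :=
    Finset.single_le_sum (f := fun j => ∑ k, ‖N j k‖ₑ) (fun _ _ => zero_le) (Finset.mem_univ j)
  calc
    matSize (M * N) ≤ ∑ i, ∑ k, ∑ j, ‖M i j‖ₑ * ‖N j k‖ₑ := by
      simp only [matSize, Matrix.mul_apply, ← enorm_mul]
      gcongr
      exact enorm_sum_le _ _
    _ = ∑ i, ∑ j, ‖M i j‖ₑ * ∑ k, ‖N j k‖ₑ := by
      simp only [Finset.mul_sum]
      exact Finset.sum_congr rfl fun i _ => Finset.sum_comm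
    _ ≤ ∑ i, ∑ j, ‖M i j‖ₑ * matSize N := by
      gcongr
      exact row_le _
    _ = matSize M * matSize N := by simp only [matSize, Finset.sum_mul]

theorem enorm_trace_le_matSize (M : Matrix ι ι ℂ) : ‖M.trace‖ₑ ≤ matSize M :=
  (enorm_sum_le _ _).trans <| Finset.sum_le_sum fun i _ =>
    Finset.single_le_sum (f := fun j => ‖M i j‖ₑ) (fun _ _ => zero_le) (Finset.mem_univ i)

theorem matSize_ne_top (M : Matrix ι ι ℂ) : matSize M ≠ ∞ := by
  simp only [matSize, ne_eq, ENNReal.sum_eq_top, enorm_ne_top, and_false, exists_false,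
    not_false_eq_true]

theorem matSize_list_prod_le [DecidableEq ι] {X : Type*} (c : X → Matrix ι ι ℂ) (l : List X) :
    matSize (l.map c).prod ≤ matSize (1 : Matrix ι ι ℂ) * (l.map fun p => matSize (c p)).prod := by
  induction l with
  | nil => simp only [List.map_nil, List.prod_nil, mul_one, le_refl]
  | cons p l ih =>
    simp only [List.map_cons, List.prod_cons]
    rw [mul_left_comm]
    exact (matSize_mul_le _ _).trans (by gcongr)

end MatrixSize

section TensorKernel

/-- The coefficient of a point of a given kind. -/
def Tensors.coeff {ι : Type} (A : Tensors ι) (p : ℝ × Kind) : Matrix ι ι ℂ :=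
  match p.2 with
  | (false, false) => A.Q p.1
  | (true, false) => A.L p.1
  | (false, true) => A.R p.1
  | (true, true) => A.T p.1

variable {I : Set ℝ} {ι : Type} [Fintype ι]

/-- Tensors with measurable entries and an everywhere bounded `T`. Every admissible tensor is
almost everywhere equal to a regular one. -/
structure Tensors.Regular (I : Set ℝ) (A : Tensors ι) : Prop where
  measurable : ∀ k i j, Measurable fun x => A.coeff (x, k) i j
  majorant : Majorant (volume.restrict I) fun p => matSize (A.coeff p)

theorem generator_eq_sum (A : Tensors ι) (x : ℝ) (X : Form (Matrix ι ι ℂ)) (g f : WaveFn) :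
    generator A x X g f = ∑ k : Kind, A.coeff (x, k) *
      X (bif k.1 then annih x g else g) (bif k.2 then annih x f else f) := by
  simp only [Fintype.sum_prod_type, Fintype.sum_bool, cond_true, cond_false, generator, lMap, rMap,
    adMap, Tensors.coeff]
  abel

theorem trace_mul_labelSum {K : Type*} [Fintype K] (B : Matrix ι ι ℂ)
    (F : List (ℝ × K) → Matrix ι ι ℂ) (l : List ℝ) :
    (B * labelSum F l).trace = labelSum (fun t => (B * F t).trace) l :=
  map_labelSum ((Matrix.traceAddMonoidHom ι ℂ).comp (AddMonoidHom.mulLeft B)) F l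

variable [DecidableEq ι]

/-- The coefficient of a configuration: `Tr (B M(x₁) ⋯ M(x_n))` in the order of the points. -/
def Tensors.kernel (A : Tensors ι) (ω : Multiset (ℝ × Kind)) : ℂ :=
  (A.B * ((ω.sort pointLe).map A.coeff).prod).trace

theorem Tensors.kernel_of_pairwise (A : Tensors ι) {t : List (ℝ × Kind)}
    (ht : t.Pairwise fun p q => p.1 < q.1) : A.kernel t = (A.B * (t.map A.coeff).prod).trace := by
  rw [Tensors.kernel, sort_pointLe_of_pairwise ht]

theorem measurable_matrix_list_prod {X : Type*} [MeasurableSpace X] {c : X → Matrix ι ι ℂ}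
    (hc : ∀ i j, Measurable fun p => c p i j) (i j : ι) :
    Measurable fun l : List X => (l.map c).prod i j := by
  suffices Measurable fun (l : List X) (i j : ι) => (l.map c).prod i j by fun_prop
  refine measurable_list_of_cons (fun q i j => ∑ k, c q.1 i k * q.2.2 k j) (by fun_prop)
    fun x l => ?_
  funext i j
  simp only [List.map_cons, List.prod_cons, Matrix.mul_apply]

theorem Tensors.Regular.measurable_kernel {A : Tensors ι} (hA : A.Regular I) :
    Measurable A.kernel := by
  have prod_meas := measurable_matrix_list_prod (c := A.coeff) fun i j =>
    measurable_from_prod_countable_left fun k => hA.measurable k i j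
  have trace_meas : Measurable fun l : List (ℝ × Kind) => (A.B * (l.map A.coeff).prod).trace := by
    simp only [Matrix.trace, Matrix.diag, Matrix.mul_apply]
    exact Finset.measurable_fun_sum _ fun i _ => Finset.measurable_fun_sum _ fun j _ =>
      (prod_meas j i).const_mul _
  exact trace_meas.comp (measurable_multiset_sort measurableSet_pointLe)

theorem Tensors.enorm_kernel_le (A : Tensors ι) (ω : Multiset (ℝ × Kind)) :
    ‖A.kernel ω‖ₑ ≤
      matSize A.B * matSize (1 : Matrix ι ι ℂ) * (ω.map fun p => matSize (A.coeff p)).prod := by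
  have map_sort : ((ω.sort pointLe).map fun p => matSize (A.coeff p)).prod =
      (ω.map fun p => matSize (A.coeff p)).prod := by
    rw [← Multiset.prod_coe, ← Multiset.map_coe, Multiset.sort_eq]
  rw [mul_assoc, ← map_sort]
  refine (enorm_trace_le_matSize _).trans ((matSize_mul_le _ _).trans ?_)
  gcongr
  exact matSize_list_prod_le _ _

theorem Tensors.Regular.isKernel {A : Tensors ι} (hA : A.Regular I) :
    IsKernel (volume.restrict I) A.kernel where
  measurable := hA.measurable_kernel
  bound := by
    lift matSize A.B * matSize (1 : Matrix ι ι ℂ) to NNReal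
      using ENNReal.mul_ne_top (matSize_ne_top _) (matSize_ne_top _) with b b_eq
    exact ⟨b, _, hA.majorant, fun ω => b_eq ▸ A.enorm_kernel_le ω⟩

theorem listWave_nil (φ : WaveFn) : listWave φ [] = φ 0 Fin.elim0 := by
  simpa using listWave_ofFn φ Fin.elim0

theorem listWave_cons (φ : WaveFn) (x : ℝ) (l : List ℝ) :
    listWave φ (x :: l) = listWave (annih x φ) l := by
  have sqrt_factorial_succ : (Real.sqrt ((l.length + 1).factorial) : ℂ) =
      (Real.sqrt l.length.factorial : ℂ) * (Real.sqrt (l.length + 1) : ℂ) := by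
    rw [← Complex.ofReal_mul, ← Real.sqrt_mul (Nat.cast_nonneg _), Nat.factorial_succ,
      Nat.cast_mul, Nat.cast_succ, mul_comm]
  have get_cons : (x :: l).get = (Fin.cons x l.get : Fin (l.length + 1) → ℝ) :=
    funext fun i => Fin.cases rfl (fun _ => rfl) i
  simp only [listWave, annih, List.length_cons]
  rw [sqrt_factorial_succ, get_cons, mul_assoc]

/-- The creating points of a list of labelled points. -/
def createList (t : List (ℝ × Kind)) : List ℝ := (t.filter fun p => p.2.1).map Prod.fst

/-- The annihilating points of a list of labelled points. -/
def annihList (t : List (ℝ × Kind)) : List ℝ := (t.filter fun p => p.2.2).map Prod.fst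

theorem listWave_createList_cons (φ : WaveFn) (x : ℝ) (k : Kind) (t : List (ℝ × Kind)) :
    listWave φ (createList ((x, k) :: t)) =
      listWave (bif k.1 then annih x φ else φ) (createList t) := by
  obtain ⟨_ | _, b⟩ := k
  exacts [rfl, listWave_cons φ x _]

theorem listWave_annihList_cons (φ : WaveFn) (x : ℝ) (k : Kind) (t : List (ℝ × Kind)) :
    listWave φ (annihList ((x, k) :: t)) =
      listWave (bif k.2 then annih x φ else φ) (annihList t) := by
  obtain ⟨b, _ | _⟩ := k
  exacts [rfl, listWave_cons φ x _]

theorem foldr_generator (A : Tensors ι) (l : List ℝ) (g f : WaveFn) :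
    l.foldr (generator A) (vacuumProj ι) g f = labelSum (fun t : List (ℝ × Kind) =>
      (conj (listWave g (createList t)) * listWave f (annihList t)) • (t.map A.coeff).prod) l := by
  induction l generalizing g f with
  | nil =>
    simp only [List.foldr_nil, labelSum, createList, annihList, List.filter_nil, List.map_nil,
      List.prod_nil, listWave_nil, vacuumProj]
  | cons x l ih =>
    simp only [List.foldr_cons, labelSum, generator_eq_sum, ih, ← labelSum_const_mul,
      listWave_createList_cons, listWave_annihList_cons, List.map_cons, List.prod_cons,
      Matrix.mul_smul]

theorem hat_createPts_of_pairwise (g : Fock I) {t : List (ℝ × Kind)}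
    (ht : t.Pairwise fun p q => p.1 < q.1) :
    hat g (createPts t) = listWave (wave g) (createList t) := by
  rw [← hat_of_pairwise g (l := createList t) (List.pairwise_map.2 (ht.filter _))]
  simp only [createPts, Multiset.filter_coe, Multiset.map_coe, createList, Bool.decide_eq_true]

theorem hat_annihPts_of_pairwise (f : Fock I) {t : List (ℝ × Kind)}
    (ht : t.Pairwise fun p q => p.1 < q.1) :
    hat f (annihPts t) = listWave (wave f) (annihList t) := by
  rw [← hat_of_pairwise f (l := annihList t) (List.pairwise_map.2 (ht.filter _))]
  simp only [annihPts, Multiset.filter_coe, Multiset.map_coe, annihList, Bool.decide_eq_true]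

theorem pairwise_of_map_fst_eq_ofFn {K : Type*} {n : ℕ} {x : Fin n → ℝ} (hx : StrictMono x)
    {t : List (ℝ × K)} (ht : t.map Prod.fst = List.ofFn x) :
    t.Pairwise fun p q => p.1 < q.1 := by
  rw [← List.pairwise_map (f := Prod.fst), ht]
  exact List.pairwise_ofFn.2 fun i j hij => hx hij

theorem dysonIntegrand_eq_labelSum (A : Tensors ι) (g f : Fock I) {n : ℕ} {x : Fin n → ℝ}
    (hx : StrictMono x) :
    dysonIntegrand A x (wave g) (wave f) = multisetLabelSum (fun ω =>
      A.kernel ω * (conj (hat g (createPts ω)) * hat f (annihPts ω))) (List.ofFn x) := by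
  rw [dysonIntegrand, foldr_generator, trace_mul_labelSum, multisetLabelSum_coe]
  refine labelSum_congr fun t t_eq => ?_
  have t_pairwise := pairwise_of_map_fst_eq_ofFn hx t_eq
  rw [A.kernel_of_pairwise t_pairwise, hat_createPts_of_pairwise g t_pairwise,
    hat_annihPts_of_pairwise f t_pairwise, Matrix.mul_smul, Matrix.trace_smul, smul_eq_mul,
    mul_comm]

/-- The Dyson series of `A` between the wave functions `g` and `f` converges to `s`; this is the
condition which `IsCMPOWith` imposes on every matrix element. -/
def HasDysonSum (I : Set ℝ) (A : Tensors ι) (g f : WaveFn) (s : ℂ) : Prop :=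
  (∀ n : ℕ, IntegrableOn (fun x : Fin n → ℝ => dysonIntegrand A x g f)
    {x | StrictMono x} (configMeasure I n)) ∧
  HasSum (fun n : ℕ => ∫ x : Fin n → ℝ in {x | StrictMono x},
    dysonIntegrand A x g f ∂(configMeasure I n)) s

theorem hasDysonSum_integral_of_eq_labelSum {K : Type*} [Fintype K] [MeasurableSpace K]
    [MeasurableSingletonClass K] {A : Tensors ι} {g f : WaveFn} {F : Multiset (ℝ × K) → ℂ}
    (F_meas : Measurable F)
    (F_integrable : Integrable (fun ω : List (ℝ × K) => F ω)
      (poisson (labelled (volume.restrict I) K)))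
    (h : ∀ {n : ℕ} {x : Fin n → ℝ}, StrictMono x →
      dysonIntegrand A x g f = multisetLabelSum F (List.ofFn x)) :
    HasDysonSum I A g f
      (∫ ω : List (ℝ × K), F ω ∂poisson (labelled (volume.restrict I) K)) := by
  have labelSum_meas := measurable_multisetLabelSum F_meas
  have labelSum_integrable :=
    integrable_poisson_labelSum _ (measurable_multiset_iff.1 F_meas) F_integrable
  refine ⟨fun n => ?_, ?_⟩
  · exact (integrableOn_strictMono_of_integrable_poisson I labelSum_meas labelSum_integrable
      n).congr_fun (fun x hx => (h hx).symm) (measurableSet_strictMono n)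
  · rw [integral_poisson_labelSum _ (measurable_multiset_iff.1 F_meas) F_integrable]
    exact (hasSum_integral_strictMono I labelSum_meas labelSum_integrable).congr_fun fun n =>
      setIntegral_congr_fun (measurableSet_strictMono n) fun x hx => h hx

theorem Tensors.Regular.hasDysonSum {A : Tensors ι} (hA : A.Regular I) (g : Fock I)
    (f : expDomain I) :
    HasDysonSum I A (wave g) (wave (f : Fock I)) (kernelForm I A.kernel g f) := by
  have kernel_meas := hA.measurable_kernel
  have integrand_meas : Measurable fun ω =>
      A.kernel ω * (conj (hat g (createPts ω)) * hat (f : Fock I) (annihPts ω)) := by fun_prop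
  exact hasDysonSum_integral_of_eq_labelSum integrand_meas (integrable_kernelForm hA.isKernel g f)
    fun hx => dysonIntegrand_eq_labelSum A g f hx

end TensorKernel

/-! ### Composition of kernels -/

section Composition

instance instMeasurableSingletonClassSum {A B : Type*} [MeasurableSpace A] [MeasurableSpace B]
    [MeasurableSingletonClass A] [MeasurableSingletonClass B] :
    MeasurableSingletonClass (A ⊕ B) where
  measurableSet_singleton
    | .inl a => Set.image_singleton ▸ (measurableSet_singleton a).inl_image
    | .inr b => Set.image_singleton ▸ (measurableSet_singleton b).inr_image

/-- The kinds of the points of a product: a point of the first factor alone, a common point, or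
a point of the second factor alone. At a common point the first factor annihilates the particle
which the second factor creates, so that its kind records whether the first factor creates and
whether the second one annihilates. -/
abbrev PairKind : Type := Bool ⊕ (Kind ⊕ Bool)

/-- The kind in the first factor of a point of a product. -/
def firstKind : PairKind → Option Kind
  | .inl a => some (a, false)
  | .inr (.inl (a, _)) => some (a, true)
  | .inr (.inr _) => none

/-- The kind in the second factor of a point of a product. -/
def secondKind : PairKind → Option Kind
  | .inl _ => none
  | .inr (.inl (_, b)) => some (true, b)
  | .inr (.inr b) => some (false, b)

variable {X : Type*}

/-- The configuration of a product with the given points of the first factor alone, common points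
and points of the second factor alone. -/
abbrev pairUnion (α : Multiset (X × Bool)) (ζ : Multiset (X × (Kind ⊕ Bool))) :
    Multiset (X × PairKind) := labelledUnion (Equiv.refl PairKind) α ζ

/-- The part of the configuration of a product which belongs to the second factor. -/
abbrev secondUnion (τ : Multiset (X × Kind)) (ρ : Multiset (X × Bool)) :
    Multiset (X × (Kind ⊕ Bool)) := labelledUnion (Equiv.refl (Kind ⊕ Bool)) τ ρ

theorem filterLabel_firstKind_pairUnion (α ρ : Multiset (X × Bool)) (τ : Multiset (X × Kind)) :
    filterLabel firstKind (pairUnion α (secondUnion τ ρ)) =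
      labelledUnion splitAnnih α (τ.map (relabel Prod.fst)) := by
  rw [pairUnion, secondUnion, filterLabel_labelledUnion, filterLabel_labelledUnion]
  simp only [Equiv.refl_apply, firstKind, filterLabel_some, filterLabel_none, add_zero,
    labelledUnion, Multiset.map_map]
  rfl

theorem filterLabel_secondKind_pairUnion (α ρ : Multiset (X × Bool)) (τ : Multiset (X × Kind)) :
    filterLabel secondKind (pairUnion α (secondUnion τ ρ)) =
      labelledUnion splitCreate (τ.map (relabel Prod.snd)) ρ := by
  rw [pairUnion, secondUnion, filterLabel_labelledUnion, filterLabel_labelledUnion]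
  simp only [Equiv.refl_apply, secondKind, filterLabel_some, filterLabel_none, zero_add,
    labelledUnion, Multiset.map_map]
  rfl

theorem labelSum_mul_multiset_relabel {M : Type*} [NonUnitalNonAssocSemiring M]
    (W J : Multiset (X × Bool) → M) (τ : List (X × Bool)) :
    labelSum (fun t : List ((X × Bool) × Bool) =>
      W (((t.map (Equiv.prodAssoc X Bool Bool) : List (X × Kind)) :
        Multiset (X × Kind)).map (relabel Prod.fst)) *
      J (((t.map (Equiv.prodAssoc X Bool Bool) : List (X × Kind)) :
        Multiset (X × Kind)).map (relabel Prod.snd))) τ =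
      W τ * multisetLabelSum J ((τ : Multiset (X × Bool)).map Prod.fst) := by
  rw [Multiset.map_coe, multisetLabelSum_coe, labelSum_map, ← labelSum_const_mul]
  refine labelSum_congr fun t t_eq => ?_
  rw [← t_eq]
  simp only [Multiset.map_coe, List.map_map]
  rfl

variable [MeasurableSpace X] {μ : Measure X} [SFinite μ]

theorem map_prodAssoc_labelled_labelled :
    (labelled (labelled μ Bool) Bool).map (Equiv.prodAssoc X Bool Bool) = labelled μ Kind := by
  have assoc_meas : Measurable (Equiv.prodAssoc X Bool Bool) := MeasurableEquiv.prodAssoc.measurable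
  refine Measure.ext_of_lintegral _ fun F hF => ?_
  rw [lintegral_map hF assoc_meas, lintegral_labelled _ hF,
    lintegral_labelled _ (hF.fun_comp assoc_meas),
    lintegral_labelled _ (Finset.measurable_fun_sum _ fun c _ => by fun_prop)]
  simp only [Fintype.sum_prod_type]
  rfl

theorem map_prodAssoc_poisson_labelled_labelled :
    (poisson (labelled (labelled μ Bool) Bool)).map (List.map (Equiv.prodAssoc X Bool Bool)) =
      poisson (labelled μ Kind) := by
  rw [← map_prodAssoc_labelled_labelled, poisson_map _ (f := Equiv.prodAssoc X Bool Bool)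
    MeasurableEquiv.prodAssoc.measurable]

theorem lintegral_mul_multiset_relabel {W J : Multiset (X × Bool) → ℝ≥0∞} (hW : Measurable W)
    (hJ : Measurable J) :
    ∫⁻ τ : List (X × Kind), W ((τ : Multiset (X × Kind)).map (relabel Prod.fst)) *
        J ((τ : Multiset (X × Kind)).map (relabel Prod.snd)) ∂poisson (labelled μ Kind) =
      ∫⁻ τ : List (X × Bool), W τ * multisetLabelSum J ((τ : Multiset (X × Bool)).map Prod.fst)
        ∂poisson (labelled μ Bool) := by
  have assoc_meas : Measurable (List.map (Equiv.prodAssoc X Bool Bool)) :=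
    measurable_list_map MeasurableEquiv.prodAssoc.measurable
  rw [← map_prodAssoc_poisson_labelled_labelled, lintegral_map (by fun_prop) assoc_meas,
    lintegral_poisson_labelSum _ (by fun_prop)]
  exact lintegral_congr fun τ => labelSum_mul_multiset_relabel W J τ

theorem integral_mul_multiset_relabel {W J : Multiset (X × Bool) → ℂ} (hW : Measurable W)
    (hJ : Measurable J)
    (hint : Integrable (fun τ : List (X × Kind) =>
      W ((τ : Multiset (X × Kind)).map (relabel Prod.fst)) *
        J ((τ : Multiset (X × Kind)).map (relabel Prod.snd))) (poisson (labelled μ Kind))) :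
    ∫ τ : List (X × Kind), W ((τ : Multiset (X × Kind)).map (relabel Prod.fst)) *
        J ((τ : Multiset (X × Kind)).map (relabel Prod.snd)) ∂poisson (labelled μ Kind) =
      ∫ τ : List (X × Bool), W τ * multisetLabelSum J ((τ : Multiset (X × Bool)).map Prod.fst)
        ∂poisson (labelled μ Bool) := by
  have assoc_meas : Measurable (List.map (Equiv.prodAssoc X Bool Bool)) :=
    measurable_list_map MeasurableEquiv.prodAssoc.measurable
  have integrand_meas : Measurable fun τ : List (X × Kind) =>
      W ((τ : Multiset (X × Kind)).map (relabel Prod.fst)) *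
        J ((τ : Multiset (X × Kind)).map (relabel Prod.snd)) := by fun_prop
  rw [← map_prodAssoc_poisson_labelled_labelled] at hint ⊢
  rw [integral_map assoc_meas.aemeasurable integrand_meas.aestronglyMeasurable]
  refine (integral_poisson_labelSum _ (integrand_meas.comp assoc_meas)
    ((integrable_map_measure integrand_meas.aestronglyMeasurable assoc_meas.aemeasurable).1
      hint)).trans ?_
  exact integral_congr_ae (.of_forall fun τ => labelSum_mul_multiset_relabel W J τ)

theorem lintegral_pairKind {u v : Multiset (X × Kind) → ℝ≥0∞} (hu : Measurable u)
    (hv : Measurable v) :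
    ∫⁻ ζ : List (X × PairKind), u (filterLabel firstKind ζ) * v (filterLabel secondKind ζ)
        ∂poisson (labelled μ PairKind) =
      ∫⁻ ω : List (X × Kind), u ω * multisetLabelSum (fun τ : Multiset (X × Bool) =>
        ∫⁻ ρ : List (X × Bool), v (labelledUnion splitCreate τ ρ) ∂poisson (labelled μ Bool))
          (annihPts ω) ∂poisson (labelled μ Kind) := by
  have first_meas := measurable_filterLabel (X := X) firstKind
  have second_meas := measurable_filterLabel (X := X) secondKind
  have inner_meas : Measurable fun τ : Multiset (X × Bool) =>
      ∫⁻ ρ : List (X × Bool), v (labelledUnion splitCreate τ ρ) ∂poisson (labelled μ Bool) :=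
    measurable_multiset_iff.2 (by fun_prop)
  have labelSum_meas := measurable_multisetLabelSum inner_meas
  rw [lintegral_poisson_labelled _ (Equiv.refl PairKind)
      (F := fun ζ => u (filterLabel firstKind ζ) * v (filterLabel secondKind ζ)) (by fun_prop),
    lintegral_poisson_labelled _ splitAnnih
      (F := fun ω => u ω * multisetLabelSum _ (annihPts ω)) (by fun_prop)]
  refine lintegral_congr fun α => ?_
  have pairUnion_meas : Measurable fun ζ : Multiset (X × (Kind ⊕ Bool)) => pairUnion α ζ :=
    measurable_multiset_iff.2 (by fun_prop)
  have union_meas : Measurable fun τ : Multiset (X × Bool) => labelledUnion splitAnnih α τ :=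
    measurable_multiset_iff.2 (by fun_prop)
  rw [lintegral_poisson_labelled _ (Equiv.refl (Kind ⊕ Bool)) (F := fun ζ =>
    u (filterLabel firstKind (pairUnion α ζ)) * v (filterLabel secondKind (pairUnion α ζ)))
    (by fun_prop)]
  simp only [filterLabel_firstKind_pairUnion, filterLabel_secondKind_pairUnion,
    annihPts_labelledUnion]
  rw [← lintegral_mul_multiset_relabel (hu.fun_comp union_meas) inner_meas]
  refine lintegral_congr fun τ => lintegral_const_mul _ ?_
  simp only [Multiset.map_coe]
  fun_prop

theorem integral_pairKind {u v : Multiset (X × Kind) → ℂ} (hu : Measurable u) (hv : Measurable v)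
    (hpair : Integrable (fun ζ : List (X × PairKind) =>
      u (filterLabel firstKind ζ) * v (filterLabel secondKind ζ)) (poisson (labelled μ PairKind)))
    (hiter : Integrable (fun ω : List (X × Kind) => u ω *
      multisetLabelSum (fun τ : Multiset (X × Bool) => ∫ ρ : List (X × Bool),
        v (labelledUnion splitCreate τ ρ) ∂poisson (labelled μ Bool)) (annihPts ω))
      (poisson (labelled μ Kind))) :
    ∫ ζ : List (X × PairKind), u (filterLabel firstKind ζ) * v (filterLabel secondKind ζ)
        ∂poisson (labelled μ PairKind) =
      ∫ ω : List (X × Kind), u ω * multisetLabelSum (fun τ : Multiset (X × Bool) =>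
        ∫ ρ : List (X × Bool), v (labelledUnion splitCreate τ ρ) ∂poisson (labelled μ Bool))
          (annihPts ω) ∂poisson (labelled μ Kind) := by
  have first_meas := measurable_filterLabel (X := X) firstKind
  have second_meas := measurable_filterLabel (X := X) secondKind
  have pair_meas : Measurable fun ζ : Multiset (X × PairKind) =>
      u (filterLabel firstKind ζ) * v (filterLabel secondKind ζ) := by fun_prop
  have inner_meas : Measurable fun τ : Multiset (X × Bool) =>
      ∫ ρ : List (X × Bool), v (labelledUnion splitCreate τ ρ) ∂poisson (labelled μ Bool) :=
    measurable_multiset_iff.2 (Measurable.stronglyMeasurable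
      (f := fun q : List (X × Bool) × List (X × Bool) => v (labelledUnion splitCreate q.1 q.2))
      (by fun_prop)).integral_prod_right'.measurable
  have labelSum_meas := measurable_multisetLabelSum inner_meas
  have iter_meas : Measurable fun ω => u ω * multisetLabelSum (fun τ : Multiset (X × Bool) =>
      ∫ ρ : List (X × Bool), v (labelledUnion splitCreate τ ρ) ∂poisson (labelled μ Bool))
        (annihPts ω) := by fun_prop
  have pair_int := (integrable_poisson_labelled_iff _ (Equiv.refl PairKind) pair_meas).1 hpair
  have iter_int := (integrable_poisson_labelled_iff _ splitAnnih iter_meas).1 hiter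
  rw [integral_poisson_labelled _ (Equiv.refl PairKind) pair_meas, integral_prod _ pair_int,
    integral_poisson_labelled _ splitAnnih iter_meas, integral_prod _ iter_int]
  refine integral_congr_ae ?_
  filter_upwards [pair_int.prod_right_ae] with α section_int
  have pairUnion_meas : Measurable fun ζ : Multiset (X × (Kind ⊕ Bool)) => pairUnion α ζ :=
    measurable_multiset_iff.2 (by fun_prop)
  have union_meas : Measurable fun τ : Multiset (X × Bool) => labelledUnion splitAnnih α τ :=
    measurable_multiset_iff.2 (by fun_prop)
  have section_meas := pair_meas.fun_comp pairUnion_meas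
  have second_int :=
    (integrable_poisson_labelled_iff _ (Equiv.refl (Kind ⊕ Bool)) section_meas).1 section_int
  refine (integral_poisson_labelled _ (Equiv.refl (Kind ⊕ Bool)) section_meas).trans ?_
  rw [integral_prod _ second_int]
  have common_int := second_int.integral_prod_left
  simp only [filterLabel_firstKind_pairUnion, filterLabel_secondKind_pairUnion,
    annihPts_labelledUnion, integral_const_mul] at common_int ⊢
  exact integral_mul_multiset_relabel (hu.fun_comp union_meas) inner_meas common_int

variable {κ₁ κ₂ : Multiset (X × Kind) → ℂ} {G φ : Multiset X → ℂ}

theorem integrable_pairKind (hκ₁ : IsKernel μ κ₁) (hκ₂ : IsKernel μ κ₂) (hG : Measurable G)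
    (hφ : Measurable φ) (hG2 : ∫⁻ l : List X, ‖G l‖ₑ ^ 2 ∂poisson μ < ∞)
    (hφ2 : ExpMoments μ fun m => ‖φ m‖ₑ) :
    Integrable (fun ζ : List (X × PairKind) =>
      (κ₁ (filterLabel firstKind ζ) * conj (G (createPts (filterLabel firstKind ζ)))) *
        (κ₂ (filterLabel secondKind ζ) * φ (annihPts (filterLabel secondKind ζ))))
      (poisson (labelled μ PairKind)) := by
  have κ₁_meas := hκ₁.measurable
  have κ₂_meas := hκ₂.measurable
  have first_meas := measurable_filterLabel (X := X) firstKind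
  have second_meas := measurable_filterLabel (X := X) secondKind
  refine ⟨Measurable.aestronglyMeasurable (by fun_prop), ?_⟩
  rw [hasFiniteIntegral_iff_enorm]
  simp only [enorm_mul, RCLike.enorm_conj]
  rw [lintegral_pairKind (u := fun ω => ‖κ₁ ω‖ₑ * ‖G (createPts ω)‖ₑ)
    (v := fun ω => ‖κ₂ ω‖ₑ * ‖φ (annihPts ω)‖ₑ) (by fun_prop) (by fun_prop)]
  simpa only [absApply, mul_assoc] using
    lintegral_kernel_lt_top hκ₁ hG.enorm (measurable_absApply (μ := μ) κ₂_meas hφ.enorm) hG2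
      (hφ2.absApply hκ₂ hφ.enorm)

theorem integral_kernelApply_eq_integral_pairKind (hκ₁ : IsKernel μ κ₁) (hκ₂ : IsKernel μ κ₂)
    (hG : Measurable G) (hφ : Measurable φ) (hG2 : ∫⁻ l : List X, ‖G l‖ₑ ^ 2 ∂poisson μ < ∞)
    (hφ2 : ExpMoments μ fun m => ‖φ m‖ₑ) :
    ∫ ω : List (X × Kind), κ₁ ω * (conj (G (createPts ω)) * kernelApply μ κ₂ φ (annihPts ω))
        ∂poisson (labelled μ Kind) =
      ∫ ζ : List (X × PairKind),
        (κ₁ (filterLabel firstKind ζ) * conj (G (createPts (filterLabel firstKind ζ)))) *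
          (κ₂ (filterLabel secondKind ζ) * φ (annihPts (filterLabel secondKind ζ)))
        ∂poisson (labelled μ PairKind) := by
  have κ₁_meas := hκ₁.measurable
  have κ₂_meas := hκ₂.measurable
  have iter_int := integrable_kernel hκ₁ hG (measurable_kernelApply (μ := μ) κ₂_meas hφ) hG2
    (hφ2.kernelApply hκ₂ hφ)
  simp only [← mul_assoc (κ₁ _)] at iter_int ⊢
  exact (integral_pairKind (u := fun ω => κ₁ ω * conj (G (createPts ω)))
    (v := fun ω => κ₂ ω * φ (annihPts ω)) (by fun_prop) (by fun_prop)
    (integrable_pairKind hκ₁ hκ₂ hG hφ hG2 hφ2) iter_int).symm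

end Composition

section CompositionForm

variable {I : Set ℝ} {κ₁ κ₂ : Multiset (ℝ × Kind) → ℂ}

theorem kernelForm_eq_integral_pairKind (hκ₁ : IsKernel (volume.restrict I) κ₁)
    (hκ₂ : IsKernel (volume.restrict I) κ₂) (g : Fock I) {f h : expDomain I}
    (hat_h : ∀ᵐ l : List ℝ ∂poisson (volume.restrict I),
      hat (h : Fock I) l = kernelApply (volume.restrict I) κ₂ (hat (f : Fock I)) l) :
    kernelForm I κ₁ g h = ∫ ζ : List (ℝ × PairKind),
      (κ₁ (filterLabel firstKind ζ) * conj (hat g (createPts (filterLabel firstKind ζ)))) *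
        (κ₂ (filterLabel secondKind ζ) * hat (f : Fock I) (annihPts (filterLabel secondKind ζ)))
      ∂poisson (labelled (volume.restrict I) PairKind) := by
  have hat_f_meas := measurable_hat (f : Fock I)
  have apply_meas := measurable_kernelApply (μ := volume.restrict I) hκ₂.measurable hat_f_meas
  rw [← integral_kernelApply_eq_integral_pairKind hκ₁ hκ₂ (measurable_hat g) hat_f_meas
    (lintegral_hat_sq_lt_top g) (expMoments_hat f)]
  refine integral_congr_ae ?_
  filter_upwards [ae_annihPts (measurableSet_eq_fun (measurable_hat (h : Fock I)) apply_meas) hat_h]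
    with ω hω
  rw [hω]

end CompositionForm

/-! ### Regular representatives of admissible tensors -/

section Representatives

variable {α : Type*} [MeasurableSpace α] {μ : Measure α}

theorem exists_stronglyMeasurable_enorm_le {E : Type*} [NormedAddCommGroup E] {φ : α → E}
    (hφ : AEStronglyMeasurable φ μ) :
    ∃ χ : α → E, StronglyMeasurable χ ∧ φ =ᵐ[μ] χ ∧ ∀ x, ‖χ x‖ₑ ≤ eLpNormEssSup φ μ := by
  have mk_meas := hφ.stronglyMeasurable_mk
  set bounded : Set α := {x | ‖hφ.mk φ x‖ₑ ≤ eLpNormEssSup φ μ}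
  refine ⟨bounded.indicator (hφ.mk φ),
    mk_meas.indicator (measurableSet_le mk_meas.enorm measurable_const), ?_, fun x => ?_⟩
  · filter_upwards [hφ.ae_eq_mk, enorm_ae_le_eLpNormEssSup φ μ] with x mk_eq le_essSup
    have x_mem : x ∈ bounded := by rwa [mk_eq] at le_essSup
    rw [mk_eq, Set.indicator_of_mem x_mem]
  · by_cases x_mem : x ∈ bounded
    · rwa [Set.indicator_of_mem x_mem]
    · simp only [Set.indicator_of_notMem x_mem, enorm_zero, zero_le]

variable {ι : Type*} {M : α → Matrix ι ι ℂ}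

theorem exists_measurable_memLp_ae_eq [Countable ι] {p : ℝ≥0∞}
    (hM : ∀ i j, MemLp (fun x => M x i j) p μ) :
    ∃ M' : α → Matrix ι ι ℂ, (∀ i j, Measurable fun x => M' x i j) ∧
      (∀ i j, MemLp (fun x => M' x i j) p μ) ∧ M =ᵐ[μ] M' := by
  refine ⟨fun x i j => (hM i j).1.mk _ x, fun i j => (hM i j).1.stronglyMeasurable_mk.measurable,
    fun i j => (hM i j).ae_eq (hM i j).1.ae_eq_mk, ?_⟩
  filter_upwards [ae_all_iff.2 fun i => ae_all_iff.2 fun j => (hM i j).1.ae_eq_mk] with x mk_eq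
  ext i j
  exact mk_eq i j

variable [Fintype ι]

theorem exists_measurable_matSize_le_ae_eq (hM : ∀ i j, MemLp (fun x => M x i j) ∞ μ) :
    ∃ M' : α → Matrix ι ι ℂ, (∀ i j, Measurable fun x => M' x i j) ∧
      (∃ t : NNReal, ∀ x, matSize (M' x) ≤ t) ∧ M =ᵐ[μ] M' := by
  choose M' M'_meas M'_eq M'_le using fun i j => exists_stronglyMeasurable_enorm_le (hM i j).1
  refine ⟨fun x i j => M' i j x, fun i j => (M'_meas i j).measurable, ?_, ?_⟩
  · lift ∑ i, ∑ j, eLpNormEssSup (fun x => M x i j) μ to NNReal using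
      ENNReal.sum_ne_top.2 fun i _ => ENNReal.sum_ne_top.2 fun j _ =>
        (eLpNorm_exponent_top (f := fun x => M x i j) (μ := μ)) ▸ (hM i j).2.ne with t t_eq
    refine ⟨t, fun x => t_eq ▸ ?_⟩
    unfold matSize
    gcongr
    exact M'_le _ _ x
  · filter_upwards [ae_all_iff.2 fun i => ae_all_iff.2 fun j => M'_eq i j] with x M_eq
    ext i j
    exact M_eq i j

theorem matSize_eq_enorm (N : Matrix ι ι ℂ) : matSize N = ‖∑ i, ∑ j, ‖N i j‖‖ₑ := by
  simp only [Real.enorm_eq_ofReal (Finset.sum_nonneg fun i _ =>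
      Finset.sum_nonneg fun j _ => norm_nonneg (N i j)),
    ENNReal.ofReal_sum_of_nonneg fun i _ => Finset.sum_nonneg fun j _ => norm_nonneg (N i j),
    ENNReal.ofReal_sum_of_nonneg fun _ _ => norm_nonneg _, ofReal_norm, matSize]

theorem memLp_sum_norm_entries {p : ℝ≥0∞} (hM : ∀ i j, MemLp (fun x => M x i j) p μ) :
    MemLp (fun x => ∑ i, ∑ j, ‖M x i j‖) p μ :=
  memLp_finsetSum _ fun i _ => memLp_finsetSum _ fun j _ => (hM i j).norm

theorem lintegral_matSize_lt_top (hM : ∀ i j, MemLp (fun x => M x i j) 1 μ) :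
    ∫⁻ x, matSize (M x) ∂μ < ∞ := by
  simp only [matSize_eq_enorm]
  exact (memLp_one_iff_integrable.1 (memLp_sum_norm_entries hM)).2

theorem lintegral_matSize_sq_lt_top (hM : ∀ i j, MemLp (fun x => M x i j) 2 μ) :
    ∫⁻ x, matSize (M x) ^ 2 ∂μ < ∞ := by
  simpa only [matSize_eq_enorm, ENNReal.toReal_ofNat, ENNReal.rpow_ofNat] using
    lintegral_rpow_enorm_lt_top_of_eLpNorm_lt_top two_ne_zero ENNReal.ofNat_ne_top
      (memLp_sum_norm_entries hM).2

end Representatives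

section Regularization

variable {I : Set ℝ} {ι : Type} {A A' : Tensors ι}

/-- Agreement of tensors almost everywhere on `I`. -/
structure Tensors.AEEq (I : Set ℝ) (A A' : Tensors ι) : Prop where
  B_eq : A.B = A'.B
  Q_ae_eq : A.Q =ᵐ[volume.restrict I] A'.Q
  L_ae_eq : A.L =ᵐ[volume.restrict I] A'.L
  R_ae_eq : A.R =ᵐ[volume.restrict I] A'.R
  T_ae_eq : A.T =ᵐ[volume.restrict I] A'.T

variable [Fintype ι]

theorem Tensors.Admissible.exists_regular (hA : A.Admissible I) :
    ∃ A' : Tensors ι, A'.Regular I ∧ A.AEEq I A' := by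
  obtain ⟨Q, Q_meas, Q_memLp, Q_eq⟩ := exists_measurable_memLp_ae_eq hA.Q_mem
  obtain ⟨L, L_meas, L_memLp, L_eq⟩ := exists_measurable_memLp_ae_eq hA.L_mem
  obtain ⟨R, R_meas, R_memLp, R_eq⟩ := exists_measurable_memLp_ae_eq hA.R_mem
  obtain ⟨T, T_meas, T_le, T_eq⟩ := exists_measurable_matSize_le_ae_eq hA.T_mem
  let A' : Tensors ι := ⟨A.B, Q, L, R, T⟩
  have coeff_meas : ∀ k i j, Measurable fun x => A'.coeff (x, k) i j := by
    rintro ⟨_ | _, _ | _⟩ i j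
    exacts [Q_meas i j, R_meas i j, L_meas i j, T_meas i j]
  refine ⟨A', ⟨coeff_meas, ?_, lintegral_matSize_lt_top Q_memLp,
    lintegral_matSize_sq_lt_top L_memLp, lintegral_matSize_sq_lt_top R_memLp, T_le⟩,
    rfl, Q_eq, L_eq, R_eq, T_eq⟩
  exact measurable_from_prod_countable_left fun k => Finset.measurable_fun_sum _ fun i _ =>
    Finset.measurable_fun_sum _ fun j _ => (coeff_meas k i j).enorm

theorem Tensors.AEEq.generator_ae_eq (h : A.AEEq I A') :
    generator A =ᵐ[volume.restrict I] generator A' := by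
  filter_upwards [h.Q_ae_eq, h.L_ae_eq, h.R_ae_eq, h.T_ae_eq] with x Q_eq L_eq R_eq T_eq
  unfold generator
  rw [Q_eq, L_eq, R_eq, T_eq]

variable [DecidableEq ι]

theorem Tensors.AEEq.dysonIntegrand_ae_eq (h : A.AEEq I A') (n : ℕ) (g f : WaveFn) :
    (fun x : Fin n → ℝ => dysonIntegrand A x g f) =ᵐ[configMeasure I n]
      fun x => dysonIntegrand A' x g f := by
  have generator_eq : ∀ᵐ x : Fin n → ℝ ∂configMeasure I n,
      ∀ i, generator A (x i) = generator A' (x i) :=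
    ae_all_iff.2 fun i => (Measure.tendsto_eval_ae_ae
      (μ := fun _ : Fin n => volume.restrict I) (i := i)).eventually h.generator_ae_eq
  filter_upwards [generator_eq] with x hx
  have foldr_eq : (List.ofFn x).foldr (generator A) (vacuumProj ι) =
      (List.ofFn x).foldr (generator A') (vacuumProj ι) :=
    List.foldr_ext _ _ _ fun y hy _ => by
      obtain ⟨i, rfl⟩ := (List.mem_ofFn' _ _).1 hy
      rw [hx i]
  rw [dysonIntegrand, dysonIntegrand, h.B_eq, foldr_eq]

theorem Tensors.AEEq.hasDysonSum (h : A.AEEq I A') {g f : WaveFn} {s : ℂ}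
    (hs : HasDysonSum I A' g f s) : HasDysonSum I A g f s := by
  have ae_eq (n : ℕ) : (fun x : Fin n → ℝ => dysonIntegrand A x g f)
      =ᵐ[(configMeasure I n).restrict {x | StrictMono x}] fun x => dysonIntegrand A' x g f :=
    ae_restrict_of_ae (h.dysonIntegrand_ae_eq n g f)
  exact ⟨fun n => (hs.1 n).congr (ae_eq n).symm,
    hs.2.congr_fun fun n => integral_congr_ae (ae_eq n)⟩

theorem isCMPOWith_iff_inner_eq_kernelForm (hA : A.Admissible I) (hA' : A'.Regular I)
    (h : A.AEEq I A') (O : expDomain I →ₗ[ℂ] expDomain I) :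
    IsCMPOWith I A O ↔ ∀ (g : Fock I) (f : expDomain I),
      ⟪g, (O f : Fock I)⟫_ℂ = kernelForm I A'.kernel g f := by
  have dyson_sum (g : Fock I) (f : expDomain I) := h.hasDysonSum (hA'.hasDysonSum g f)
  refine ⟨fun hO g f => (hO.2 g f).2.unique (dyson_sum g f).2, fun hO => ⟨hA, fun g f => ?_⟩⟩
  rw [hO]
  exact dyson_sum g f

theorem existsUnique_isCMPOWith (hA : A.Admissible I) :
    ∃! O : expDomain I →ₗ[ℂ] expDomain I, IsCMPOWith I A O := by
  obtain ⟨A', hA', h⟩ := hA.exists_regular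
  obtain ⟨O, hO⟩ := exists_linearMap_inner_eq_kernelForm hA'.isKernel
  refine ⟨O, (isCMPOWith_iff_inner_eq_kernelForm hA hA' h O).2 hO, fun O' hO' => ?_⟩
  ext1 f
  refine Subtype.ext (ext_inner_left ℂ fun g => ?_)
  rw [hO, (isCMPOWith_iff_inner_eq_kernelForm hA hA' h O').1 hO']

end Regularization

/-! ### The product rule -/

section Product

variable {I : Set ℝ} {ι κ : Type}

theorem Tensors.Admissible.prod [DecidableEq ι] [DecidableEq κ] {A₁ : Tensors ι}
    {A₂ : Tensors κ} (h₁ : A₁.Admissible I) (h₂ : A₂.Admissible I) :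
    (A₁.prod A₂).Admissible I where
  Q_mem i j :=
    (((h₁.Q_mem i.1 j.1).mul_const _).add ((h₂.Q_mem i.2 j.2).const_mul _)).add
      ((h₂.L_mem i.2 j.2).mul (p := 2) (q := 2) (h₁.R_mem i.1 j.1))
  L_mem i j := ((h₁.L_mem i.1 j.1).mul_const _).add
    ((h₂.L_mem i.2 j.2).mul (p := ∞) (q := 2) (h₁.T_mem i.1 j.1))
  R_mem i j := ((h₂.R_mem i.2 j.2).const_mul _).add
    ((h₂.T_mem i.2 j.2).mul (p := 2) (q := ∞) (h₁.R_mem i.1 j.1))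
  T_mem i j := (h₂.T_mem i.2 j.2).mul (p := ∞) (q := ∞) (h₁.T_mem i.1 j.1)

theorem Tensors.AEEq.prod [DecidableEq ι] [DecidableEq κ] {A₁ A₁' : Tensors ι}
    {A₂ A₂' : Tensors κ} (h₁ : A₁.AEEq I A₁') (h₂ : A₂.AEEq I A₂') :
    (A₁.prod A₂).AEEq I (A₁'.prod A₂') where
  B_eq := by rw [Tensors.prod, Tensors.prod, h₁.B_eq, h₂.B_eq]
  Q_ae_eq := by
    filter_upwards [h₁.Q_ae_eq, h₂.Q_ae_eq, h₁.R_ae_eq, h₂.L_ae_eq] with x Q₁ Q₂ R₁ L₂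
    simp only [Tensors.prod, Q₁, Q₂, R₁, L₂]
  L_ae_eq := by
    filter_upwards [h₁.L_ae_eq, h₁.T_ae_eq, h₂.L_ae_eq] with x L₁ T₁ L₂
    simp only [Tensors.prod, L₁, T₁, L₂]
  R_ae_eq := by
    filter_upwards [h₂.R_ae_eq, h₁.R_ae_eq, h₂.T_ae_eq] with x R₂ R₁ T₂
    simp only [Tensors.prod, R₂, R₁, T₂]
  T_ae_eq := by
    filter_upwards [h₁.T_ae_eq, h₂.T_ae_eq] with x T₁ T₂
    simp only [Tensors.prod, T₁, T₂]

/-- The points of a labelled list which keep a label under a partial change of labels, in their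
order; the ordered version of `filterLabel`. -/
def filterList {A B : Type*} (c : A → Option B) (t : List (ℝ × A)) : List (ℝ × B) :=
  t.filterMap fun p => (c p.2).map fun k => (p.1, k)

theorem filterLabel_coe {A B : Type*} (c : A → Option B) (t : List (ℝ × A)) :
    filterLabel c (t : Multiset (ℝ × A)) = (filterList c t : Multiset (ℝ × B)) := rfl

theorem pairwise_filterList {A B : Type*} (c : A → Option B) {t : List (ℝ × A)}
    (ht : t.Pairwise fun p q => p.1 < q.1) :
    (filterList c t).Pairwise fun p q => p.1 < q.1 := by
  refine List.Pairwise.filterMap _ (fun p q hpq b hb b' hb' => ?_) ht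
  obtain ⟨_, _, rfl⟩ := Option.map_eq_some_iff.1 hb
  obtain ⟨_, _, rfl⟩ := Option.map_eq_some_iff.1 hb'
  exact hpq

theorem filterList_cons_of_eq_none {A B : Type*} {c : A → Option B} {a : A} (h : c a = none)
    (x : ℝ) (t : List (ℝ × A)) : filterList c ((x, a) :: t) = filterList c t := by
  simp only [filterList, List.filterMap_cons, h, Option.map_none]

theorem filterList_cons_of_eq_some {A B : Type*} {c : A → Option B} {a : A} {k : B}
    (h : c a = some k) (x : ℝ) (t : List (ℝ × A)) :
    filterList c ((x, a) :: t) = (x, k) :: filterList c t := by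
  simp only [filterList, List.filterMap_cons, h, Option.map_some]

theorem prod_map_filterList_cons {A B M : Type*} [Monoid M] (c : A → Option B) (q : ℝ × B → M)
    (x : ℝ) (a : A) (t : List (ℝ × A)) :
    ((filterList c ((x, a) :: t)).map q).prod =
      (c a).elim 1 (fun k => q (x, k)) * ((filterList c t).map q).prod := by
  cases h : c a with
  | none => rw [filterList_cons_of_eq_none h, Option.elim_none, one_mul]
  | some k => rw [filterList_cons_of_eq_some h, List.map_cons, List.prod_cons, Option.elim_some]

theorem listWave_createList_filterList_cons {A : Type*} (c : A → Option Kind) (φ : WaveFn) (x : ℝ)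
    (a : A) (t : List (ℝ × A)) :
    listWave φ (createList (filterList c ((x, a) :: t))) =
      listWave (bif (c a).elim false Prod.fst then annih x φ else φ)
        (createList (filterList c t)) := by
  cases h : c a with
  | none => rw [filterList_cons_of_eq_none h, Option.elim_none, cond_false]
  | some k => rw [filterList_cons_of_eq_some h, listWave_createList_cons, Option.elim_some]

theorem listWave_annihList_filterList_cons {A : Type*} (c : A → Option Kind) (φ : WaveFn) (x : ℝ)
    (a : A) (t : List (ℝ × A)) :
    listWave φ (annihList (filterList c ((x, a) :: t))) =
      listWave (bif (c a).elim false Prod.snd then annih x φ else φ)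
        (annihList (filterList c t)) := by
  cases h : c a with
  | none => rw [filterList_cons_of_eq_none h, Option.elim_none, cond_false]
  | some k => rw [filterList_cons_of_eq_some h, listWave_annihList_cons, Option.elim_some]

variable [Fintype ι] [DecidableEq ι] [Fintype κ] [DecidableEq κ]

theorem generator_prod_eq_sum (A₁ : Tensors ι) (A₂ : Tensors κ) (x : ℝ)
    (X : Form (Matrix (ι × κ) (ι × κ) ℂ)) (g f : WaveFn) :
    generator (A₁.prod A₂) x X g f = ∑ c : PairKind,
      ((firstKind c).elim 1 (fun k => A₁.coeff (x, k)) ⊗ₖ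
        (secondKind c).elim 1 fun k => A₂.coeff (x, k)) *
      X (bif (firstKind c).elim false Prod.fst then annih x g else g)
        (bif (secondKind c).elim false Prod.snd then annih x f else f) := by
  simp only [Fintype.sum_sum_type, Fintype.sum_prod_type, Fintype.sum_bool, firstKind, secondKind,
    Option.elim_some, Option.elim_none, cond_true, cond_false, generator, lMap, rMap, adMap,
    Tensors.prod, Tensors.coeff, add_mul]
  abel

theorem foldr_generator_prod (A₁ : Tensors ι) (A₂ : Tensors κ) (l : List ℝ) (g f : WaveFn) :
    l.foldr (generator (A₁.prod A₂)) (vacuumProj (ι × κ)) g f =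
      labelSum (fun t : List (ℝ × PairKind) =>
        (conj (listWave g (createList (filterList firstKind t))) *
          listWave f (annihList (filterList secondKind t))) •
        (((filterList firstKind t).map A₁.coeff).prod ⊗ₖ
          ((filterList secondKind t).map A₂.coeff).prod)) l := by
  induction l generalizing g f with
  | nil =>
    simp only [List.foldr_nil, labelSum, filterList, List.filterMap_nil, createList, annihList,
      List.filter_nil, List.map_nil, List.prod_nil, listWave_nil, vacuumProj,
      Matrix.one_kronecker_one]
  | cons x l ih =>
    simp only [List.foldr_cons, labelSum, generator_prod_eq_sum, ih, ← labelSum_const_mul,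
      listWave_createList_filterList_cons, listWave_annihList_filterList_cons,
      prod_map_filterList_cons, Matrix.mul_smul, Matrix.mul_kronecker_mul]

theorem dysonIntegrand_prod_eq_labelSum (A₁ : Tensors ι) (A₂ : Tensors κ) (g f : Fock I) {n : ℕ}
    {x : Fin n → ℝ} (hx : StrictMono x) :
    dysonIntegrand (A₁.prod A₂) x (wave g) (wave f) = multisetLabelSum (fun ζ =>
      (A₁.kernel (filterLabel firstKind ζ) * conj (hat g (createPts (filterLabel firstKind ζ)))) *
        (A₂.kernel (filterLabel secondKind ζ) * hat f (annihPts (filterLabel secondKind ζ))))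
      (List.ofFn x) := by
  rw [dysonIntegrand, foldr_generator_prod, trace_mul_labelSum, multisetLabelSum_coe]
  refine labelSum_congr fun t t_eq => ?_
  have t_pairwise := pairwise_of_map_fst_eq_ofFn hx t_eq
  have first_pairwise := pairwise_filterList firstKind t_pairwise
  have second_pairwise := pairwise_filterList secondKind t_pairwise
  rw [filterLabel_coe, filterLabel_coe, A₁.kernel_of_pairwise first_pairwise,
    A₂.kernel_of_pairwise second_pairwise, hat_createPts_of_pairwise g first_pairwise,
    hat_annihPts_of_pairwise f second_pairwise, Matrix.mul_smul, Matrix.trace_smul, smul_eq_mul,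
    Tensors.prod, ← Matrix.mul_kronecker_mul, Matrix.trace_kronecker]
  ring

theorem IsCMPOWith.comp {A₁ : Tensors ι} {A₂ : Tensors κ}
    {O₁ O₂ : expDomain I →ₗ[ℂ] expDomain I} (h₁ : IsCMPOWith I A₁ O₁) (h₂ : IsCMPOWith I A₂ O₂) :
    IsCMPOWith I (A₁.prod A₂) (O₁ ∘ₗ O₂) := by
  obtain ⟨A₁', regular₁, ae_eq₁⟩ := h₁.1.exists_regular
  obtain ⟨A₂', regular₂, ae_eq₂⟩ := h₂.1.exists_regular
  have inner_O₁ := (isCMPOWith_iff_inner_eq_kernelForm h₁.1 regular₁ ae_eq₁ O₁).1 h₁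
  have inner_O₂ := (isCMPOWith_iff_inner_eq_kernelForm h₂.1 regular₂ ae_eq₂ O₂).1 h₂
  refine ⟨h₁.1.prod h₂.1, fun g f => (ae_eq₁.prod ae_eq₂).hasDysonSum ?_⟩
  have hat_O₂ := ae_hat_of_inner_eq_kernelForm regular₂.isKernel fun g => inner_O₂ g f
  rw [LinearMap.comp_apply, inner_O₁,
    kernelForm_eq_integral_pairKind regular₁.isKernel regular₂.isKernel g hat_O₂]
  have kernel₁_meas := regular₁.measurable_kernel
  have kernel₂_meas := regular₂.measurable_kernel
  have first_meas := measurable_filterLabel (X := ℝ) firstKind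
  have second_meas := measurable_filterLabel (X := ℝ) secondKind
  have integrand_meas : Measurable fun ζ =>
      (A₁'.kernel (filterLabel firstKind ζ) *
        conj (hat g (createPts (filterLabel firstKind ζ)))) *
      (A₂'.kernel (filterLabel secondKind ζ) *
        hat (f : Fock I) (annihPts (filterLabel secondKind ζ))) := by fun_prop
  exact hasDysonSum_integral_of_eq_labelSum integrand_meas
    (integrable_pairKind regular₁.isKernel regular₂.isKernel (measurable_hat g)
      (measurable_hat (f : Fock I)) (lintegral_hat_sq_lt_top g) (expMoments_hat f))
    fun hx => dysonIntegrand_prod_eq_labelSum A₁' A₂' g f hx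

end Product

section Reindex

variable {I : Set ℝ} {ι κ : Type} [Fintype ι] [DecidableEq ι] [Fintype κ] [DecidableEq κ]

/-- Tensors with renamed bond indices. -/
def Tensors.reindex {ι κ : Type} (e : ι ≃ κ) (A : Tensors ι) : Tensors κ where
  B := A.B.submatrix e.symm e.symm
  Q x := (A.Q x).submatrix e.symm e.symm
  L x := (A.L x).submatrix e.symm e.symm
  R x := (A.R x).submatrix e.symm e.symm
  T x := (A.T x).submatrix e.symm e.symm

theorem foldr_generator_reindex (e : ι ≃ κ) (A : Tensors ι) (l : List ℝ) (g f : WaveFn) :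
    l.foldr (generator (A.reindex e)) (vacuumProj κ) g f =
      (l.foldr (generator A) (vacuumProj ι) g f).submatrix e.symm e.symm := by
  induction l generalizing g f with
  | nil =>
    simp only [List.foldr_nil, vacuumProj, Matrix.submatrix_smul, Pi.smul_apply,
      Matrix.submatrix_one_equiv]
  | cons x l ih =>
    simp only [List.foldr_cons, generator, lMap, rMap, adMap, ih]
    simp only [Tensors.reindex, Matrix.submatrix_mul_equiv, Matrix.submatrix_add, Pi.add_apply]

theorem dysonIntegrand_reindex (e : ι ≃ κ) (A : Tensors ι) {n : ℕ} (x : Fin n → ℝ)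
    (g f : WaveFn) : dysonIntegrand (A.reindex e) x g f = dysonIntegrand A x g f := by
  rw [dysonIntegrand, dysonIntegrand, foldr_generator_reindex, Tensors.reindex,
    Matrix.submatrix_mul_equiv]
  exact Fintype.sum_equiv e.symm _ _ fun _ => rfl

theorem IsCMPOWith.reindex (e : ι ≃ κ) {A : Tensors ι} {O : expDomain I →ₗ[ℂ] expDomain I}
    (h : IsCMPOWith I A O) : IsCMPOWith I (A.reindex e) O := by
  refine ⟨⟨fun i j => h.1.Q_mem _ _, fun i j => h.1.L_mem _ _, fun i j => h.1.R_mem _ _,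
    fun i j => h.1.T_mem _ _⟩, fun g f => ?_⟩
  simp only [dysonIntegrand_reindex]
  exact h.2 g f

theorem IsCMPOWith.isCMPO_card {A : Tensors ι} {O : expDomain I →ₗ[ℂ] expDomain I}
    (h : IsCMPOWith I A O) : IsCMPO I (Fintype.card ι) O :=
  ⟨_, h.reindex (Fintype.equivFin ι)⟩

end Reindex

end CMPO

end

theorem mainTheorem1_general (I : Set ℝ) :
    (∀ (ι : Type) [Fintype ι] [DecidableEq ι] (A : CMPO.Tensors ι), A.Admissible I →
      ∃! O : CMPO.expDomain I →ₗ[ℂ] CMPO.expDomain I, CMPO.IsCMPOWith I A O) ∧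
    (∀ (ι κ : Type) [Fintype ι] [DecidableEq ι] [Fintype κ] [DecidableEq κ]
      (A₁ : CMPO.Tensors ι) (A₂ : CMPO.Tensors κ)
      (O₁ O₂ : CMPO.expDomain I →ₗ[ℂ] CMPO.expDomain I),
      CMPO.IsCMPOWith I A₁ O₁ → CMPO.IsCMPOWith I A₂ O₂ →
        CMPO.IsCMPOWith I (A₁.prod A₂) (O₁ ∘ₗ O₂) ∧
        ∃ D ≤ Fintype.card ι * Fintype.card κ, CMPO.IsCMPO I D (O₁ ∘ₗ O₂)) :=
  ⟨fun _ _ _ _ hA => CMPO.existsUnique_isCMPOWith hA, fun ι κ _ _ _ _ _ _ _ _ h₁ h₂ =>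
    ⟨h₁.comp h₂, _, (Fintype.card_prod ι κ).le, (h₁.comp h₂).isCMPO_card⟩⟩

theorem mainTheorem1 (I : Set ℝ) (hI : I.OrdConnected) :
    -- admissible tensors define an operator, and only one
    (∀ (D : ℕ) (A : CMPO.Tensors (Fin D)), A.Admissible I →
      ∃! O : CMPO.expDomain I →ₗ[ℂ] CMPO.expDomain I, CMPO.IsCMPOWith I A O) ∧
    -- the product rule
    (∀ (D₁ D₂ : ℕ) (A₁ : CMPO.Tensors (Fin D₁)) (A₂ : CMPO.Tensors (Fin D₂))
      (O₁ O₂ : CMPO.expDomain I →ₗ[ℂ] CMPO.expDomain I),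
      CMPO.IsCMPOWith I A₁ O₁ → CMPO.IsCMPOWith I A₂ O₂ →
        CMPO.IsCMPOWith I (A₁.prod A₂) (O₁ ∘ₗ O₂) ∧
        ∃ D ≤ D₁ * D₂, CMPO.IsCMPO I D (O₁ ∘ₗ O₂)) :=
  ⟨fun D => (mainTheorem1_general I).1 (Fin D), fun D₁ D₂ => by
    simpa only [Fintype.card_fin] using (mainTheorem1_general I).2 (Fin D₁) (Fin D₂)⟩
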